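/- Let $O=(Y,X,Z)$ have law $P$, with $Y,X$ real-valued and $Z$ in a measurable space, and let $v:\mathbb R\to\mathbb R$ be a known measurable function. For a law $Q$ of $O$ write $m(z)=E(Y|Z=z)$, $\pi(z)=E(X|Z=z)$, $\rho(z)=E\{v(X)|Z=z\}$, $\gamma(z)=\mathrm{Cov}\{v(X),Y|Z=z\}$, $\beta(z)=\mathrm{Cov}\{v(X),X|Z=z\}$, $\lambda(z)=\gamma(z)/\beta(z)$, $l(x|z)=\{v(x)-\rho(z)\}/\beta(z)$ (all under $Q$), and, with $(Y',X')$ an independent copy of $(Y,X)$ given $Z$, $\gamma_*(z)=E\{|v(X)-v(X')||Y-Y'|\,|\,Z=z\}$, $\beta_*(z)=E\{|v(X)-v(X')||X-X'|\,|\,Z=z\}$ (if $v$ is monotone on the support of $X$, then $\beta_*=2|\beta|$). A submodel through $P$ with score $s$ ($s$ bounded and measurable) is a family of laws $P_t$ which, for $t$ near $0$, have densities $1+ts+o(t)$ with respect to $P$, with $o(t)$ uniform. A function $\phi$ is an influence function of a functional $\Psi$ at $P$ in a nonparametric model $\mathcal M$ (a set of laws) if $E_P\phi(O)=0$, $E_P\phi(O)^2<\infty$,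 and along every submodel $P_t\in\mathcal M$ for $t$ near $0$ and $\frac{d}{dt}\Psi(P_t)\big|_{t=0}=E_P\{\phi(O)s(O)\}$. (1) Let $w$ be a known measurable function of $z$, and let $\mathcal M$ be the set of laws under which the conditional covariances $\gamma,\beta$ exist almost surely (that is, given $Z$, the variables $v(X),X,Y,v(X)X,v(X)Y$ are integrable), $\beta(Z)\neq0$ and $\beta_*(Z)\le K|\beta(Z)|$ almost surely for some constant $K$, and $E|w(Z)\gamma_*(Z)/\beta(Z)|<\infty$. Let $P\in\mathcal M$, $\Lambda=E\{w(Z)\lambda(Z)\}$ and $\tilde m(x,z)=m(z)+\lambda(z)\{x-\pi(z)\}$. If $$\phi_\Lambda(y,x,z)=w(z)\,l(x|z)\{y-\tilde m(x,z)\}+w(z)\lambda(z)-\Lambda$$ has finite variance under $P$, then it is the (almost surely unique) influence function of $Q\mapsto E_Q\{w(Z)\lambda_Q(Z)\}$ at $P$ in $\mathcal M$. (2) Let $\bar{\mathcal M}$ be the set of laws under which $\gamma,\beta$ exist almost surely, $E\gamma_*(Z)<\infty$, $E\beta_*(Z)<\infty$ and $E\beta(Z)\ne0$. Let $P\in\bar{\mathcal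 M}$ with $\beta(Z)\neq0$ almost surely, $\bar\Lambda=E\{\gamma(Z)\}/E\{\beta(Z)\}$ and $w(z)=\beta(z)/E\{\beta(Z)\}$, and suppose that $$\phi_{\bar\Lambda}(y,x,z)=w(z)\,l(x|z)\bigl[y-m(z)-\bar\Lambda\{x-\pi(z)\}\bigr]$$ has finite variance under $P$. Then $E\{w(Z)\}=1$, $\bar\Lambda=E\{w(Z)\lambda(Z)\}$, and $\phi_{\bar\Lambda}$ is the (almost surely unique) influence function of $Q\mapsto E_Q\{\gamma_Q(Z)\}/E_Q\{\beta_Q(Z)\}$ at $P$ in $\bar{\mathcal M}$. (3) Let $(y_i,x_i,z_i)$, $i=1,\dots,n$, $n\ge1$, be a sample and let $\hat m,\hat\pi,\hat\rho,\hat\beta,\hat\lambda$ be fitted functions of $z$. With these in place of the true ones, the sample mean of the influence curve in (1), as a function of the unknown $\Lambda$, is zero if and only if $\Lambda$ equals $$\hat\Lambda=n^{-1}\sum_{i=1}^n\Bigl(w(z_i)\frac{v(x_i)-\hat\rho(z_i)}{\hat\beta(z_i)}\bigl[y_i-\hat m(z_i)-\hat\lambda(z_i)\{x_i-\hat\pi(z_i)\}\bigr]+w(z_i)\hat\lambda(z_i)\Bigr).$$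 If all $\hat\beta(z_i)\neq0$ and $\sum_i\{v(x_i)-\hat\rho(z_i)\}\{x_i-\hat\pi(z_i)\}\ne0$, the sample mean of the influence curve in (2), with fitted weight $\hat\beta(z)/c$ for any constant $c\neq0$, is zero if and only if $\bar\Lambda$ equals $$\hat{\bar\Lambda}=\frac{\sum_{i=1}^n\{v(x_i)-\hat\rho(z_i)\}\{y_i-\hat m(z_i)\}}{\sum_{i=1}^n\{v(x_i)-\hat\rho(z_i)\}\{x_i-\hat\pi(z_i)\}}.$$ -/

import Mathlib

open MeasureTheory ProbabilityTheory Filter Topology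

noncomputable section

namespace ContrastEffect

variable {𝒵 : Type*} [MeasurableSpace 𝒵]

/-- One observation `o = (y, x, z)`: outcome, exposure, confounders. -/
abbrev Obs (𝒵 : Type*) := ℝ × ℝ × 𝒵

/-- The marginal law of `Z` when `(Y, X, Z)` has law `Q`. -/
def lawZ (Q : ProbabilityMeasure (Obs 𝒵)) : Measure 𝒵 :=
  (Q : Measure (Obs 𝒵)).map (fun o => o.2.2)

/-- The regular conditional law of `(Y, X)` given `Z = z`. -/
def condLaw (Q : ProbabilityMeasure (Obs 𝒵)) : Kernel 𝒵 (ℝ × ℝ) :=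
  condDistrib (fun o : Obs 𝒵 => (o.1, o.2.1)) (fun o : Obs 𝒵 => o.2.2) (Q : Measure (Obs 𝒵))

/-! ### Nuisance functions -/

/-- `m(z) = E(Y | Z = z)`. -/
def outcomeMean (Q : ProbabilityMeasure (Obs 𝒵)) (z : 𝒵) : ℝ :=
  ∫ a, a.1 ∂(condLaw Q z)

/-- `π(z) = E(X | Z = z)`. -/
def exposureMean (Q : ProbabilityMeasure (Obs 𝒵)) (z : 𝒵) : ℝ :=
  ∫ a, a.2 ∂(condLaw Q z)

/-- `ρ(z) = E{v(X) | Z = z}`. -/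
def vMean (v : ℝ → ℝ) (Q : ProbabilityMeasure (Obs 𝒵)) (z : 𝒵) : ℝ :=
  ∫ a, v a.2 ∂(condLaw Q z)

/-- `Cov{v(X), Y | Z = z}`. -/
def covVY (v : ℝ → ℝ) (Q : ProbabilityMeasure (Obs 𝒵)) (z : 𝒵) : ℝ :=
  covariance (fun a : ℝ × ℝ => v a.2) (fun a => a.1) (condLaw Q z)

/-- `β(z) = Cov{v(X), X | Z = z}`. -/
def covVX (v : ℝ → ℝ) (Q : ProbabilityMeasure (Obs 𝒵)) (z : 𝒵) : ℝ :=
  covariance (fun a : ℝ × ℝ => v a.2) (fun a => a.2) (condLaw Q z)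

/-- `λ(z) = Cov{v(X), Y | Z = z} / Cov{v(X), X | Z = z}`. -/
def condEffect (v : ℝ → ℝ) (Q : ProbabilityMeasure (Obs 𝒵)) (z : 𝒵) : ℝ :=
  covVY v Q z / covVX v Q z

/-! ### Estimands -/

/-- `E{w(Z) λ(Z)}` for a known function `w`; the case `w = 1` is `Λ`. -/
def lambdaEstimand (v : ℝ → ℝ) (w : 𝒵 → ℝ) (Q : ProbabilityMeasure (Obs 𝒵)) : ℝ :=
  ∫ z, w z * condEffect v Q z ∂(lawZ Q)

/-- `Λ̄ = E[Cov{v(X), Y | Z}] / E[Cov{v(X), X | Z}]`. -/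
def lambdaBarEstimand (v : ℝ → ℝ) (Q : ProbabilityMeasure (Obs 𝒵)) : ℝ :=
  (∫ z, covVY v Q z ∂(lawZ Q)) / (∫ z, covVX v Q z ∂(lawZ Q))

/-- The normalized subgroup weight proportional to `Cov{v(X), X | Z = z}`. -/
def covWeight (v : ℝ → ℝ) (Q : ProbabilityMeasure (Obs 𝒵)) (z : 𝒵) : ℝ :=
  covVX v Q z / ∫ z', covVX v Q z' ∂(lawZ Q)

/-! ### The nonparametric models: laws at which the estimands are well defined -/

/-- The covariance of `f` and `g` under `μ` exists. -/
def CovExists (f g : ℝ × ℝ → ℝ) (μ : Measure (ℝ × ℝ)) : Prop :=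
  Integrable f μ ∧ Integrable g μ ∧ Integrable (fun a => f a * g a) μ

/-- `E |f(A) - f(A')| |g(A) - g(A')|` for independent copies `A`, `A'` with law `μ`. Without the
absolute values this is twice the covariance of `f(A)` and `g(A)`. -/
def absCov (f g : ℝ × ℝ → ℝ) (μ : Measure (ℝ × ℝ)) : ℝ :=
  ∫ p, |f p.1 - f p.2| * |g p.1 - g p.2| ∂(μ.prod μ)

/-- `absCov` of `v(X)` and `Y` given `Z = z`. -/
def absCovVY (v : ℝ → ℝ) (Q : ProbabilityMeasure (Obs 𝒵)) (z : 𝒵) : ℝ :=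
  absCov (fun a => v a.2) (fun a => a.1) (condLaw Q z)

/-- `absCov` of `v(X)` and `X` given `Z = z`; it equals `2 |Cov{v(X), X | Z = z}|` if `v` is
monotone (increasing or decreasing) on the support of `X`. -/
def absCovVX (v : ℝ → ℝ) (Q : ProbabilityMeasure (Obs 𝒵)) (z : 𝒵) : ℝ :=
  absCov (fun a => v a.2) (fun a => a.2) (condLaw Q z)

/-- The conditional covariances of `v(X)` with `Y` and with `X` given `Z` exist. -/
def CondCovExist (v : ℝ → ℝ) (Q : ProbabilityMeasure (Obs 𝒵)) : Prop :=
  ∀ᵐ z ∂(lawZ Q),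
    CovExists (fun a => v a.2) (fun a => a.1) (condLaw Q z) ∧
    CovExists (fun a => v a.2) (fun a => a.2) (condLaw Q z)

/-- The nonparametric model for `E{w(Z) λ(Z)}`: the conditional covariances exist, the denominator
`Cov{v(X), X | Z}` does not vanish and, relative to the spread of `v(X)` and `X`, is bounded away
from zero (for monotone `v` this last clause holds with `K = 2`), and the integrand is integrable
together with its absolute version. -/
def lambdaModel (v : ℝ → ℝ) (w : 𝒵 → ℝ) : Set (ProbabilityMeasure (Obs 𝒵)) :=
  {Q | CondCovExist v Q ∧
    (∀ᵐ z ∂(lawZ Q), covVX v Q z ≠ 0) ∧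
    (∃ K : ℝ, ∀ᵐ z ∂(lawZ Q), absCovVX v Q z ≤ K * |covVX v Q z|) ∧
    Integrable (fun z => w z * absCovVY v Q z / covVX v Q z) (lawZ Q)}

/-- The nonparametric model for `Λ̄`: the conditional covariances exist, are integrable together
with their absolute versions, and the denominator of `Λ̄` does not vanish. -/
def lambdaBarModel (v : ℝ → ℝ) : Set (ProbabilityMeasure (Obs 𝒵)) :=
  {Q | CondCovExist v Q ∧
    Integrable (absCovVY v Q) (lawZ Q) ∧
    Integrable (absCovVX v Q) (lawZ Q) ∧
    ∫ z, covVX v Q z ∂(lawZ Q) ≠ 0}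

/-! ### Influence functions -/

/-- `t ↦ Q t` is a one-dimensional submodel through `P` with bounded score `s`: near `t = 0`, `Q t`
has a density with respect to `P`, and this density is `1 + t s + o(t)` uniformly. For every
bounded `s` with mean zero under `P` the densities `1 + t s` give such a submodel, so the scores are
dense in the mean-zero square-integrable functions: the model is nonparametric. -/
def IsSubmodel {𝒪 : Type*} [MeasurableSpace 𝒪] (P : ProbabilityMeasure 𝒪) (s : 𝒪 → ℝ)
    (Q : ℝ → ProbabilityMeasure 𝒪) : Prop :=
  Measurable s ∧ (∃ B : ℝ, ∀ o, |s o| ≤ B) ∧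
  ∃ p : ℝ → 𝒪 → ℝ, (∀ t, Measurable (p t)) ∧ (∀ t o, 0 ≤ p t o) ∧
    (∀ᶠ t in 𝓝 (0 : ℝ),
      (Q t : Measure 𝒪) = (P : Measure 𝒪).withDensity (fun o => ENNReal.ofReal (p t o))) ∧
    (∀ ε > 0, ∀ᶠ t in 𝓝 (0 : ℝ), ∀ᵐ o ∂(P : Measure 𝒪), |p t o - 1 - t * s o| ≤ ε * |t|)

/-- `φ` is an influence function of `Ψ` at `P` in the nonparametric model `M`: it has mean zero and
finite variance, and along every submodel with score `s` the law stays in `M` near `t = 0` and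
`Ψ` has derivative `E{φ(O) s(O)}` at `t = 0`. -/
def IsInfluenceFunction {𝒪 : Type*} [MeasurableSpace 𝒪] (M : Set (ProbabilityMeasure 𝒪))
    (Ψ : ProbabilityMeasure 𝒪 → ℝ) (P : ProbabilityMeasure 𝒪) (φ : 𝒪 → ℝ) : Prop :=
  MemLp φ 2 (P : Measure 𝒪) ∧ ∫ o, φ o ∂(P : Measure 𝒪) = 0 ∧
  ∀ (s : 𝒪 → ℝ) (Q : ℝ → ProbabilityMeasure 𝒪), IsSubmodel P s Q →
    (∀ᶠ t in 𝓝 (0 : ℝ), Q t ∈ M) ∧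
    HasDerivAt (fun t => Ψ (Q t)) (∫ o, φ o * s o ∂(P : Measure 𝒪)) 0

/-- `φ` is, up to almost sure equality, the only influence function of `Ψ` at `P`. -/
def IsTheInfluenceFunction {𝒪 : Type*} [MeasurableSpace 𝒪] (M : Set (ProbabilityMeasure 𝒪))
    (Ψ : ProbabilityMeasure 𝒪 → ℝ) (P : ProbabilityMeasure 𝒪) (φ : 𝒪 → ℝ) : Prop :=
  IsInfluenceFunction M Ψ P φ ∧
  ∀ φ' : 𝒪 → ℝ, IsInfluenceFunction M Ψ P φ' → φ' =ᵐ[(P : Measure 𝒪)] φ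

/-! ### The influence curves, for arbitrary values of the nuisance functions -/

/-- The contrast function `l(x|z) = {v(x) - ρ(z)} / β(z)`. -/
def contrast (v : ℝ → ℝ) (ρ β : 𝒵 → ℝ) (x : ℝ) (z : 𝒵) : ℝ := (v x - ρ z) / β z

/-- `w(z) l(x|z) {y - m̃(x,z)} + w(z) λ(z) - θ` with `m̃(x,z) = m(z) + λ(z) {x - π(z)}`. -/
def icLambda (v : ℝ → ℝ) (w ρ β m π lam : 𝒵 → ℝ) (θ : ℝ) (o : Obs 𝒵) : ℝ :=
  w o.2.2 * contrast v ρ β o.2.1 o.2.2 * (o.1 - (m o.2.2 + lam o.2.2 * (o.2.1 - π o.2.2)))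
    + w o.2.2 * lam o.2.2 - θ

/-- `w(z) l(x|z) {y - m̄(x,z)}` with `m̄(x,z) = m(z) + θ {x - π(z)}`. -/
def icLambdaBar (v : ℝ → ℝ) (w ρ β m π : 𝒵 → ℝ) (θ : ℝ) (o : Obs 𝒵) : ℝ :=
  w o.2.2 * contrast v ρ β o.2.1 o.2.2 * (o.1 - (m o.2.2 + θ * (o.2.1 - π o.2.2)))

/-- The influence curve of `E{w(Z) λ(Z)}` at the law `P`. -/
def phiLambda (v : ℝ → ℝ) (w : 𝒵 → ℝ) (P : ProbabilityMeasure (Obs 𝒵)) : Obs 𝒵 → ℝ :=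
  icLambda v w (vMean v P) (covVX v P) (outcomeMean P) (exposureMean P) (condEffect v P)
    (lambdaEstimand v w P)

/-- The influence curve of `Λ̄` at the law `P`. -/
def phiLambdaBar (v : ℝ → ℝ) (P : ProbabilityMeasure (Obs 𝒵)) : Obs 𝒵 → ℝ :=
  icLambdaBar v (covWeight v P) (vMean v P) (covVX v P) (outcomeMean P) (exposureMean P)
    (lambdaBarEstimand v P)

/-! ### The estimators, from a sample and fitted nuisance functions -/

/-- The estimator of `E{w(Z) λ(Z)}`; the case `w = 1` estimates `Λ`. -/
def lambdaHat (v : ℝ → ℝ) (w ρ β m π lam : 𝒵 → ℝ) {n : ℕ} (o : Fin n → Obs 𝒵) : ℝ :=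
  (n : ℝ)⁻¹ * ∑ i, (w (o i).2.2 * ((v (o i).2.1 - ρ (o i).2.2) / β (o i).2.2) *
      ((o i).1 - m (o i).2.2 - lam (o i).2.2 * ((o i).2.1 - π (o i).2.2))
    + w (o i).2.2 * lam (o i).2.2)

/-- The estimator of `Λ̄`. -/
def lambdaBarHat (v : ℝ → ℝ) (ρ m π : 𝒵 → ℝ) {n : ℕ} (o : Fin n → Obs 𝒵) : ℝ :=
  (∑ i, (v (o i).2.1 - ρ (o i).2.2) * ((o i).1 - m (o i).2.2)) /
    ∑ i, (v (o i).2.1 - ρ (o i).2.2) * ((o i).2.1 - π (o i).2.2)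

end ContrastEffect

end

namespace ContrastEffect

/-! ### Integrals with bounded weights -/

/-! A covariance is half an integral over pairs: for independent copies `A`, `A'`, `2 Cov(f, g) = E
(f(A) - f(A')) (g(A) - g(A'))`. Passing to a density `h` multiplies the pair integrand by `h(A)
h(A')`, so the unnormalized covariance `tiltCov` is quadratic in `h`. If `h` is within `δ` of `1 +
tσ` and `|σ| ≤ B`, the weight is within `t²B² + 4δ` of `1 + t(σ(A) + σ(A'))`, and the error in
`tiltCov` is at most that multiple of `absCov` (`CovExists.abs_tiltCov_sub_le`). No moments beyond
the existence of the covariance enter, and the error is uniform in `z` relative to `absCov`; this is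
why the models are phrased through γ_* and β_*.

Along a submodel with density `p`, the law of `Z` acquires the density `c(z) = E(p | Z = z)`, and
the law given `z` is tilted by `p / c(z)` (`IsPerturbation.lawZ_eq`,
`IsPerturbation.condLaw_ae_eq`). Against the old law of `Z`, the integrand of a mean covariance
becomes `c · T / c² = T / c`, and that of the weighted effect becomes `w c T_Y / T_X`, where `T`
stands for `tiltCov`. Both have the form `A S / E` with factors known to first order
(`abs_mul_div_sub_le`); the bound `β_* ≤ K|β|` keeps `T_X / β` near 1 uniformly in `z`. Integrating
the remainder against an integrable envelope gives the derivative
(`hasDerivAt_integral_of_remainder_le`), and disintegrating `E(φ s)` over `Z` identifies it. The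
ratio of mean covariances then follows from the quotient rule. The same bounds keep the submodel
inside the model.

Uniqueness holds because `1_A - P(A)` is a bounded score for every event `A`, and pairing it with a
mean-zero `φ` returns the integral of `φ` over `A`. The estimators arise because both estimating
equations are affine in the parameter. -/

theorem integrable_mul_of_abs_le {α : Type*} [MeasurableSpace α] {μ : Measure α} {F k : α → ℝ}
    (hF : Integrable F μ) (hk : Measurable k) {B : ℝ} (hB : ∀ x, |k x| ≤ B) :
    Integrable (fun x => F x * k x) μ :=
  hF.mul_bdd hk.aestronglyMeasurable (ae_of_all _ hB)

theorem integrable_withDensity_of_abs_le {α : Type*} [MeasurableSpace α] {μ : Measure α}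
    {F k : α → ℝ} (hF : Integrable F μ) (hk : Measurable k) {B : ℝ} (hB : ∀ x, |k x| ≤ B) :
    Integrable F (μ.withDensity fun x => ENNReal.ofReal (k x)) := by
  rw [integrable_withDensity_iff_integrable_smul' (by fun_prop)
    (ae_of_all _ fun _ => ENNReal.ofReal_lt_top)]
  simp only [ENNReal.toReal_ofReal', smul_eq_mul]
  refine (integrable_mul_of_abs_le hF (k := fun x => max (k x) 0) (B := B) (by fun_prop)
    fun x => ?_).congr (ae_of_all _ fun _ => mul_comm _ _)
  rw [abs_of_nonneg (le_max_right _ _)]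
  exact max_le ((le_abs_self _).trans (hB x)) ((abs_nonneg _).trans (hB x))

theorem integral_withDensity_ofReal {α : Type*} [MeasurableSpace α] {μ : Measure α}
    (F : α → ℝ) {k : α → ℝ} (hk : Measurable k) (h0 : ∀ x, 0 ≤ k x) :
    ∫ x, F x ∂(μ.withDensity fun x => ENNReal.ofReal (k x)) = ∫ x, k x * F x ∂μ := by
  rw [integral_withDensity_eq_integral_toReal_smul (by fun_prop)
    (ae_of_all _ fun _ => ENNReal.ofReal_lt_top)]
  simp only [ENNReal.toReal_ofReal (h0 _), smul_eq_mul]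

/-! ### Covariances as integrals over pairs -/

section Covariance

variable {ν : Measure (ℝ × ℝ)} [IsProbabilityMeasure ν] {f g h σ : ℝ × ℝ → ℝ}

theorem CovExists.integrable_centered (hfg : CovExists f g ν) (a b : ℝ) :
    Integrable (fun x => (f x - a) * (g x - b)) ν := by
  obtain ⟨hf, hg, hm⟩ := hfg
  have := ((hm.sub (hg.const_mul a)).sub (hf.mul_const b)).add (integrable_const (a * b))
  refine this.congr (ae_of_all _ fun x => ?_)
  simp only [Pi.add_apply, Pi.sub_apply]
  ring

theorem CovExists.integral_centered (hfg : CovExists f g ν) (a b : ℝ) :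
    ∫ x, (f x - a) * (g x - b) ∂ν =
      (∫ x, f x * g x ∂ν) - a * (∫ x, g x ∂ν) - (∫ x, f x ∂ν) * b + a * b := by
  obtain ⟨hf, hg, hm⟩ := hfg
  have h1 := integral_sub hm (hg.const_mul a)
  have h2 := integral_sub (hm.sub (hg.const_mul a)) (hf.mul_const b)
  have h3 := integral_add ((hm.sub (hg.const_mul a)).sub (hf.mul_const b))
    (integrable_const (a * b))
  simp only [Pi.sub_apply, integral_const_mul, integral_mul_const, integral_const, probReal_univ,
    one_smul] at h1 h2 h3
  rw [h2, h1] at h3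
  rw [← h3]
  exact integral_congr_ae (ae_of_all _ fun x => by ring)

/-- Centre both differences at the means: when one copy is integrated out, the cross terms vanish.
-/
theorem CovExists.integral_pair_right (hfg : CovExists f g ν) (a : ℝ × ℝ) :
    ∫ b, (f a - f b) * (g a - g b) ∂ν =
      (f a - ∫ x, f x ∂ν) * (g a - ∫ x, g x ∂ν) + covariance f g ν := by
  have h1 : ∫ b, (f a - f b) * (g a - g b) ∂ν = ∫ b, (f b - f a) * (g b - g a) ∂ν :=
    integral_congr_ae (ae_of_all _ fun x => by ring)
  rw [h1, covariance, hfg.integral_centered, hfg.integral_centered]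
  ring

theorem CovExists.integrable_pair (hfg : CovExists f g ν) :
    Integrable (fun p : (ℝ × ℝ) × (ℝ × ℝ) => (f p.1 - f p.2) * (g p.1 - g p.2)) (ν.prod ν) := by
  obtain ⟨hf, hg, hm⟩ := hfg
  have := (((hm.comp_fst ν).add (hm.comp_snd ν)).sub (hf.mul_prod hg)).sub (hg.mul_prod hf)
  refine this.congr (ae_of_all _ fun x => ?_)
  simp only [Pi.add_apply, Pi.sub_apply]
  ring

theorem CovExists.integrable_abs_pair (hfg : CovExists f g ν) :
    Integrable (fun p : (ℝ × ℝ) × (ℝ × ℝ) => |f p.1 - f p.2| * |g p.1 - g p.2|) (ν.prod ν) :=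
  hfg.integrable_pair.abs.congr (ae_of_all _ fun _ => abs_mul _ _)

theorem absCov_nonneg (f g : ℝ × ℝ → ℝ) (ν : Measure (ℝ × ℝ)) : 0 ≤ absCov f g ν :=
  integral_nonneg fun _ => by positivity

/-- The derivative, in the direction `σ`, of the unnormalized covariance of `f` and `g`. -/
noncomputable def covDeriv (f g σ : ℝ × ℝ → ℝ) (ν : Measure (ℝ × ℝ)) : ℝ :=
  ∫ x, σ x * ((f x - ∫ y, f y ∂ν) * (g x - ∫ y, g y ∂ν)) ∂ν + covariance f g ν * ∫ x, σ x ∂ν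

/-- The covariance of `f` and `g` under the unnormalized measure with density `h`, times the
square of its mass. -/
noncomputable def tiltCov (f g h : ℝ × ℝ → ℝ) (ν : Measure (ℝ × ℝ)) : ℝ :=
  (∫ p, (f p.1 - f p.2) * (g p.1 - g p.2) * (h p.1 * h p.2) ∂(ν.prod ν)) / 2

/-- Exchanging the two copies shows that both halves of `σ p.1 + σ p.2` contribute equally;
integrating out the unweighted copy in one half gives `covDeriv`. -/
theorem CovExists.integral_pair_mul_add (hfg : CovExists f g ν) (hσ : Measurable σ) {B : ℝ}
    (hB : ∀ x, |σ x| ≤ B) :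
    ∫ p, (f p.1 - f p.2) * (g p.1 - g p.2) * (σ p.1 + σ p.2) ∂(ν.prod ν) =
      2 * covDeriv f g σ ν := by
  have hi1 : Integrable (fun p : (ℝ × ℝ) × (ℝ × ℝ) =>
      (f p.1 - f p.2) * (g p.1 - g p.2) * σ p.1) (ν.prod ν) :=
    integrable_mul_of_abs_le hfg.integrable_pair (hσ.comp measurable_fst) fun _ => hB _
  have hi2 : Integrable (fun p : (ℝ × ℝ) × (ℝ × ℝ) =>
      (f p.1 - f p.2) * (g p.1 - g p.2) * σ p.2) (ν.prod ν) :=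
    integrable_mul_of_abs_le hfg.integrable_pair (hσ.comp measurable_snd) fun _ => hB _
  have hs : ∫ p, (f p.1 - f p.2) * (g p.1 - g p.2) * σ p.2 ∂(ν.prod ν) =
      ∫ p, (f p.1 - f p.2) * (g p.1 - g p.2) * σ p.1 ∂(ν.prod ν) := by
    rw [← integral_prod_swap]
    exact integral_congr_ae (ae_of_all _ fun p => by simp only [Prod.fst_swap, Prod.snd_swap]; ring)
  have h1 : ∫ p, (f p.1 - f p.2) * (g p.1 - g p.2) * σ p.1 ∂(ν.prod ν) = covDeriv f g σ ν := by
    rw [integral_prod _ hi1, covDeriv, ← integral_const_mul, ← integral_add]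
    · refine integral_congr_ae (ae_of_all _ fun a => ?_)
      simp only [integral_mul_const, hfg.integral_pair_right]
      ring
    · exact (integrable_mul_of_abs_le (hfg.integrable_centered _ _) hσ hB).congr
        (ae_of_all _ fun _ => mul_comm _ _)
    · exact (Integrable.of_bound hσ.aestronglyMeasurable B (ae_of_all _ hB)).const_mul _
  simp only [mul_add]
  rw [integral_add hi1 hi2, hs, h1]
  ring

theorem CovExists.integral_pair (hfg : CovExists f g ν) :
    ∫ p, (f p.1 - f p.2) * (g p.1 - g p.2) ∂(ν.prod ν) = 2 * covariance f g ν := by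
  -- With `σ = 1/2` the weight is 1 and `covDeriv` collapses to the covariance.
  have := hfg.integral_pair_mul_add (σ := fun _ => 1 / 2) measurable_const (B := 1 / 2)
    (fun _ => by norm_num)
  norm_num [covDeriv, integral_const_mul] at this
  rw [this, covariance]
  ring

/-- Makes `absCov` the common envelope: the bounds on the covariance, on its derivative and on the
expansion error are all instances. -/
theorem CovExists.abs_integral_pair_mul_le (hfg : CovExists f g ν)
    {k : (ℝ × ℝ) × (ℝ × ℝ) → ℝ} {B : ℝ} (hB : ∀ x, |k x| ≤ B) :
    |∫ p, (f p.1 - f p.2) * (g p.1 - g p.2) * k p ∂(ν.prod ν)| ≤ B * absCov f g ν := by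
  rw [absCov, ← integral_const_mul]
  rw [← Real.norm_eq_abs]
  refine norm_integral_le_of_norm_le (hfg.integrable_abs_pair.const_mul B)
    (ae_of_all _ fun p => ?_)
  rw [Real.norm_eq_abs, abs_mul, abs_mul, mul_comm B]
  exact mul_le_mul_of_nonneg_left (hB p) (by positivity)

theorem CovExists.abs_covariance_le (hfg : CovExists f g ν) :
    2 * |covariance f g ν| ≤ absCov f g ν := by
  have := hfg.abs_integral_pair_mul_le (k := fun _ => 1) (B := 1) (fun _ => by norm_num)
  simp only [mul_one, one_mul, hfg.integral_pair] at this
  rwa [abs_mul, abs_two] at this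

theorem CovExists.abs_covDeriv_le (hfg : CovExists f g ν) (hσ : Measurable σ) {B : ℝ}
    (hB : ∀ x, |σ x| ≤ B) : |covDeriv f g σ ν| ≤ B * absCov f g ν := by
  have := hfg.abs_integral_pair_mul_le (k := fun p => σ p.1 + σ p.2) (B := 2 * B)
    (fun p => (abs_add_le _ _).trans (by linarith [hB p.1, hB p.2]))
  rw [hfg.integral_pair_mul_add hσ hB, abs_mul, abs_two] at this
  linarith

/-- First-order expansion of the unnormalized covariance. -/
theorem CovExists.abs_tiltCov_sub_le (hfg : CovExists f g ν) (hσ : Measurable σ)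
    (hh : Measurable h) {B t δ : ℝ} (hB : ∀ x, |σ x| ≤ B) (hδ : ∀ x, |h x - 1 - t * σ x| ≤ δ)
    (hsmall : |t| * B + δ ≤ 1 / 2) :
    |tiltCov f g h ν - covariance f g ν - t * covDeriv f g σ ν| ≤
      (t ^ 2 * B ^ 2 + 4 * δ) * absCov f g ν := by
  have hδ0 : 0 ≤ δ := (abs_nonneg _).trans (hδ (0, 0))
  have hB0 : 0 ≤ B := (abs_nonneg _).trans (hB (0, 0))
  have htσ : ∀ x, |t * σ x| ≤ |t| * B := fun x => by
    rw [abs_mul]; exact mul_le_mul_of_nonneg_left (hB x) (abs_nonneg t)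
  have hh2 : ∀ x, |h x| ≤ 2 := fun x => by
    have h1 := abs_le.1 (hδ x)
    have h2 := abs_le.1 (htσ x)
    exact abs_le.2 ⟨by linarith, by linarith⟩
  have hk : ∀ p : (ℝ × ℝ) × (ℝ × ℝ), |h p.1 * h p.2 - 1 - t * (σ p.1 + σ p.2)| ≤
      t ^ 2 * B ^ 2 + 4 * δ := fun p => by
    -- One second-order term in `t`, plus each remainder times a factor of size at most 2: hence
    -- `t²B² + 4δ`.
    have e : h p.1 * h p.2 - 1 - t * (σ p.1 + σ p.2) = (t * σ p.1) * (t * σ p.2)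
      + (h p.1 - 1 - t * σ p.1) * (1 + t * σ p.2) + (h p.2 - 1 - t * σ p.2) * h p.1 := by ring
    rw [e]
    have b1 : |(t * σ p.1) * (t * σ p.2)| ≤ t ^ 2 * B ^ 2 := by
      rw [abs_mul]
      calc _ ≤ (|t| * B) * (|t| * B) :=
            mul_le_mul (htσ _) (htσ _) (abs_nonneg _) (by positivity)
        _ = t ^ 2 * B ^ 2 := by rw [← sq_abs t]; ring
    have b2 : |(h p.1 - 1 - t * σ p.1) * (1 + t * σ p.2)| ≤ δ * 2 := by
      rw [abs_mul]
      refine mul_le_mul (hδ _) ?_ (abs_nonneg _) hδ0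
      have h2 := abs_le.1 (htσ p.2)
      exact abs_le.2 ⟨by linarith, by linarith⟩
    have b3 : |(h p.2 - 1 - t * σ p.2) * h p.1| ≤ δ * 2 := by
      rw [abs_mul]
      exact mul_le_mul (hδ _) (hh2 _) (abs_nonneg _) hδ0
    exact (abs_add_three _ _ _).trans (by linarith)
  have hi := hfg.integrable_pair
  have hi1 : Integrable (fun p : (ℝ × ℝ) × (ℝ × ℝ) =>
      (f p.1 - f p.2) * (g p.1 - g p.2) * (h p.1 * h p.2)) (ν.prod ν) :=
    integrable_mul_of_abs_le hi (by fun_prop) (B := 2 * 2) fun p => by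
      rw [abs_mul]; exact mul_le_mul (hh2 _) (hh2 _) (abs_nonneg _) (by norm_num)
  have hi2 : Integrable (fun p : (ℝ × ℝ) × (ℝ × ℝ) =>
      (f p.1 - f p.2) * (g p.1 - g p.2) * (σ p.1 + σ p.2)) (ν.prod ν) :=
    integrable_mul_of_abs_le hi (by fun_prop) (B := B + B) fun p =>
      (abs_add_le _ _).trans (add_le_add (hB _) (hB _))
  have hmain := hfg.abs_integral_pair_mul_le hk
  have e : ∫ p, (f p.1 - f p.2) * (g p.1 - g p.2) *
      (h p.1 * h p.2 - 1 - t * (σ p.1 + σ p.2)) ∂(ν.prod ν) =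
      2 * (tiltCov f g h ν - covariance f g ν - t * covDeriv f g σ ν) := by
    have e1 := integral_sub (hi1.sub hi) (hi2.const_mul t)
    simp only [Pi.sub_apply] at e1
    rw [integral_sub hi1 hi, integral_const_mul, hfg.integral_pair,
      hfg.integral_pair_mul_add hσ hB] at e1
    rw [tiltCov]
    calc _ = _ := integral_congr_ae (ae_of_all _ fun p => by ring)
      _ = _ := e1
      _ = _ := by ring
  rw [e, abs_mul, abs_two] at hmain
  have : 0 ≤ |tiltCov f g h ν - covariance f g ν - t * covDeriv f g σ ν| := abs_nonneg _
  linarith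

/-! ### Covariances under a change of measure -/

/-- The probability measure with density proportional to `h`. -/
noncomputable def tilt (ν : Measure (ℝ × ℝ)) (h : ℝ × ℝ → ℝ) : Measure (ℝ × ℝ) :=
  ν.withDensity fun x => ENNReal.ofReal (h x / ∫ y, h y ∂ν)

theorem integral_mem_of_bounds (hh : Measurable h) (h1 : ∀ x, 1 / 2 ≤ h x)
    (h2 : ∀ x, h x ≤ 3 / 2) : 1 / 2 ≤ ∫ x, h x ∂ν ∧ ∫ x, h x ∂ν ≤ 3 / 2 := by
  have hi : Integrable h ν := Integrable.of_bound hh.aestronglyMeasurable (3 / 2)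
    (ae_of_all _ fun x => abs_le.2 ⟨by linarith [h1 x], h2 x⟩)
  constructor
  · simpa using integral_mono (integrable_const (1 / 2 : ℝ)) hi h1
  · simpa using integral_mono hi (integrable_const (3 / 2 : ℝ)) h2

/-- The constant 3 is `(3/2) / (1/2)`. -/
theorem tilt_density_bounds (hh : Measurable h) (h1 : ∀ x, 1 / 2 ≤ h x) (h2 : ∀ x, h x ≤ 3 / 2)
    (x : ℝ × ℝ) : 0 ≤ h x / ∫ y, h y ∂ν ∧ h x / ∫ y, h y ∂ν ≤ 3 := by
  obtain ⟨c1, c2⟩ := integral_mem_of_bounds (ν := ν) hh h1 h2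
  have c0 : 0 < ∫ y, h y ∂ν := by linarith
  exact ⟨div_nonneg (by linarith [h1 x]) c0.le, (div_le_iff₀ c0).2 (by linarith [h2 x])⟩

theorem isProbabilityMeasure_tilt (hh : Measurable h) (h1 : ∀ x, 1 / 2 ≤ h x)
    (h2 : ∀ x, h x ≤ 3 / 2) : IsProbabilityMeasure (tilt ν h) := by
  obtain ⟨c1, c2⟩ := integral_mem_of_bounds (ν := ν) hh h1 h2
  constructor
  have hb := tilt_density_bounds (ν := ν) hh h1 h2
  rw [tilt, withDensity_apply _ MeasurableSet.univ, setLIntegral_univ,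
    ← ofReal_integral_eq_lintegral_ofReal]
  · rw [integral_div, div_self (by linarith), ENNReal.ofReal_one]
  · exact Integrable.of_bound (by fun_prop) 3
      (ae_of_all _ fun x => abs_le.2 ⟨by linarith [(hb x).1], (hb x).2⟩)
  · exact ae_of_all _ fun x => (hb x).1

theorem CovExists.tilt (hfg : CovExists f g ν) (hh : Measurable h) (h1 : ∀ x, 1 / 2 ≤ h x)
    (h2 : ∀ x, h x ≤ 3 / 2) : CovExists f g (tilt ν h) := by
  have hb : ∀ x, |h x / ∫ y, h y ∂ν| ≤ 3 := fun x => by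
    have := tilt_density_bounds (ν := ν) hh h1 h2 x
    exact abs_le.2 ⟨by linarith, this.2⟩
  exact ⟨integrable_withDensity_of_abs_le hfg.1 (by fun_prop) hb,
    integrable_withDensity_of_abs_le hfg.2.1 (by fun_prop) hb,
    integrable_withDensity_of_abs_le hfg.2.2 (by fun_prop) hb⟩

theorem integral_prod_tilt (hh : Measurable h) (h1 : ∀ x, 1 / 2 ≤ h x) (h2 : ∀ x, h x ≤ 3 / 2)
    (F : (ℝ × ℝ) × (ℝ × ℝ) → ℝ) :
    ∫ p, F p ∂((tilt ν h).prod (tilt ν h)) =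
      (∫ p, F p * (h p.1 * h p.2) ∂(ν.prod ν)) / (∫ x, h x ∂ν) ^ 2 := by
  have hb := tilt_density_bounds (ν := ν) hh h1 h2
  rw [tilt, prod_withDensity (by fun_prop) (by fun_prop)]
  simp only [← ENNReal.ofReal_mul (hb _).1]
  rw [integral_withDensity_ofReal (μ := ν.prod ν) F
    (k := fun p => (h p.1 / ∫ y, h y ∂ν) * (h p.2 / ∫ y, h y ∂ν)) (by fun_prop)
    fun p => mul_nonneg (hb p.1).1 (hb p.2).1, ← integral_div]
  exact integral_congr_ae (ae_of_all _ fun p => by ring)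

/-- The product of two normalized densities carries the squared mass in the denominator. -/
theorem CovExists.covariance_tilt (hfg : CovExists f g ν) (hh : Measurable h)
    (h1 : ∀ x, 1 / 2 ≤ h x) (h2 : ∀ x, h x ≤ 3 / 2) :
    covariance f g (ContrastEffect.tilt ν h) = tiltCov f g h ν / (∫ x, h x ∂ν) ^ 2 := by
  have := isProbabilityMeasure_tilt (ν := ν) hh h1 h2
  have e := (hfg.tilt hh h1 h2).integral_pair
  rw [integral_prod_tilt hh h1 h2] at e
  rw [tiltCov]
  linear_combination -e / 2

/-- The pair weight is at most `9/4` and the squared mass at least `1/4`; their ratio is 9. -/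
theorem CovExists.absCov_tilt_le (hfg : CovExists f g ν) (hh : Measurable h)
    (h1 : ∀ x, 1 / 2 ≤ h x) (h2 : ∀ x, h x ≤ 3 / 2) :
    absCov f g (ContrastEffect.tilt ν h) ≤ 9 * absCov f g ν := by
  obtain ⟨c1, c2⟩ := integral_mem_of_bounds (ν := ν) hh h1 h2
  rw [absCov, integral_prod_tilt hh h1 h2]
  have hk : ∀ p : (ℝ × ℝ) × (ℝ × ℝ), |h p.1 * h p.2| ≤ 9 / 4 := fun p => by
    rw [abs_mul, abs_of_nonneg (by linarith [h1 p.1]), abs_of_nonneg (by linarith [h1 p.2])]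
    nlinarith [h1 p.1, h1 p.2, h2 p.1, h2 p.2]
  have hI : ∫ p, |f p.1 - f p.2| * |g p.1 - g p.2| * (h p.1 * h p.2) ∂(ν.prod ν) ≤
      9 / 4 * absCov f g ν := by
    rw [absCov, ← integral_const_mul]
    refine integral_mono (integrable_mul_of_abs_le hfg.integrable_abs_pair (by fun_prop) hk)
      (hfg.integrable_abs_pair.const_mul _) fun p => ?_
    have := (le_abs_self _).trans (hk p)
    have h0 : 0 ≤ |f p.1 - f p.2| * |g p.1 - g p.2| := by positivity
    calc _ ≤ |f p.1 - f p.2| * |g p.1 - g p.2| * (9 / 4) := mul_le_mul_of_nonneg_left this h0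
      _ = _ := mul_comm _ _
  rw [div_le_iff₀ (by positivity)]
  have h0 := absCov_nonneg f g ν
  have hc : 1 / 4 ≤ (∫ x, h x ∂ν) ^ 2 := by nlinarith
  nlinarith [mul_le_mul_of_nonneg_left hc h0]

end Covariance

variable {𝒵 : Type*} [MeasurableSpace 𝒵]

/-! ### Disintegration of the law of an observation -/

instance (Q : ProbabilityMeasure (Obs 𝒵)) : IsProbabilityMeasure (lawZ Q) :=
  Measure.isProbabilityMeasure_map (by fun_prop)

instance (Q : ProbabilityMeasure (Obs 𝒵)) : IsMarkovKernel (condLaw Q) := by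
  unfold condLaw; infer_instance

theorem lawZ_compProd_condLaw (Q : ProbabilityMeasure (Obs 𝒵)) :
    lawZ Q ⊗ₘ condLaw Q = (Q : Measure (Obs 𝒵)).map (fun o => (o.2.2, (o.1, o.2.1))) :=
  compProd_map_condDistrib (by fun_prop)

/-- The function of `(y, x)` obtained by fixing `z`. -/
def slice (s : Obs 𝒵 → ℝ) (z : 𝒵) (a : ℝ × ℝ) : ℝ := s (a.1, a.2, z)

theorem measurable_slice {s : Obs 𝒵 → ℝ} (hs : Measurable s) (z : 𝒵) : Measurable (slice s z) := by
  unfold slice; fun_prop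

theorem lintegral_obs (Q : ProbabilityMeasure (Obs 𝒵)) {F : Obs 𝒵 → ENNReal} (hF : Measurable F) :
    ∫⁻ o, F o ∂(Q : Measure (Obs 𝒵)) =
      ∫⁻ z, ∫⁻ a, F (a.1, a.2, z) ∂(condLaw Q z) ∂(lawZ Q) := by
  have h : Measurable fun x : 𝒵 × (ℝ × ℝ) => F (x.2.1, x.2.2, x.1) := by fun_prop
  rw [← Measure.lintegral_compProd h, lawZ_compProd_condLaw, lintegral_map h (by fun_prop)]

theorem integral_obs (Q : ProbabilityMeasure (Obs 𝒵)) {F : Obs 𝒵 → ℝ}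
    (hF : Integrable F (Q : Measure (Obs 𝒵))) :
    ∫ o, F o ∂(Q : Measure (Obs 𝒵)) = ∫ z, ∫ a, slice F z a ∂(condLaw Q z) ∂(lawZ Q) := by
  -- Rearranging coordinates by a measurable equivalence transports integrals without asking `F` to
  -- be measurable.
  let e : Obs 𝒵 ≃ᵐ 𝒵 × (ℝ × ℝ) :=
    { toFun := fun o => (o.2.2, (o.1, o.2.1))
      invFun := fun x => (x.2.1, x.2.2, x.1)
      left_inv := fun _ => rfl
      right_inv := fun _ => rfl
      measurable_toFun := by change Measurable fun o : Obs 𝒵 => (o.2.2, (o.1, o.2.1)); fun_prop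
      measurable_invFun := by
        change Measurable fun x : 𝒵 × (ℝ × ℝ) => (x.2.1, x.2.2, x.1); fun_prop }
  have he : lawZ Q ⊗ₘ condLaw Q = (Q : Measure (Obs 𝒵)).map e := lawZ_compProd_condLaw Q
  have hi : Integrable (fun x : 𝒵 × (ℝ × ℝ) => F (e.symm x)) (lawZ Q ⊗ₘ condLaw Q) := by
    rw [he, integrable_map_equiv]
    simpa [Function.comp_def] using hF
  have := Measure.integral_compProd hi
  rw [he, integral_map_equiv] at this
  simp only [MeasurableEquiv.symm_apply_apply] at this
  exact this

theorem measurable_integral_condLaw (Q : ProbabilityMeasure (Obs 𝒵)) {F : Obs 𝒵 → ℝ}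
    (hF : Measurable F) : Measurable fun z => ∫ a, slice F z a ∂(condLaw Q z) := by
  have h : StronglyMeasurable fun x : 𝒵 × (ℝ × ℝ) => F (x.2.1, x.2.2, x.1) :=
    Measurable.stronglyMeasurable (by fun_prop)
  exact h.integral_kernel_prod_right'.measurable

theorem measurable_covariance_condLaw (Q : ProbabilityMeasure (Obs 𝒵)) {f g : ℝ × ℝ → ℝ}
    (hf : Measurable f) (hg : Measurable g) :
    Measurable fun z => covariance f g (condLaw Q z) := by
  have h1 := measurable_integral_condLaw Q (F := fun o => f (o.1, o.2.1)) (by fun_prop)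
  have h2 := measurable_integral_condLaw Q (F := fun o => g (o.1, o.2.1)) (by fun_prop)
  exact measurable_integral_condLaw Q
    (F := fun o => (f (o.1, o.2.1) - ∫ a, f a ∂(condLaw Q o.2.2)) *
      (g (o.1, o.2.1) - ∫ a, g a ∂(condLaw Q o.2.2)))
    (((by fun_prop : Measurable fun o : Obs 𝒵 => f (o.1, o.2.1)).sub
      (h1.comp (measurable_snd.comp measurable_snd))).mul
      ((by fun_prop : Measurable fun o : Obs 𝒵 => g (o.1, o.2.1)).sub
      (h2.comp (measurable_snd.comp measurable_snd))))

theorem measurable_covDeriv_condLaw (Q : ProbabilityMeasure (Obs 𝒵)) {f g : ℝ × ℝ → ℝ}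
    {s : Obs 𝒵 → ℝ} (hf : Measurable f) (hg : Measurable g) (hs : Measurable s) :
    Measurable fun z => covDeriv f g (slice s z) (condLaw Q z) := by
  have h1 := measurable_integral_condLaw Q (F := fun o => f (o.1, o.2.1)) (by fun_prop)
  have h2 := measurable_integral_condLaw Q (F := fun o => g (o.1, o.2.1)) (by fun_prop)
  refine Measurable.add (measurable_integral_condLaw Q
    (F := fun o => s o * ((f (o.1, o.2.1) - ∫ a, f a ∂(condLaw Q o.2.2)) *
      (g (o.1, o.2.1) - ∫ a, g a ∂(condLaw Q o.2.2))))
    (hs.mul (((by fun_prop : Measurable fun o : Obs 𝒵 => f (o.1, o.2.1)).sub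
      (h1.comp (measurable_snd.comp measurable_snd))).mul
      ((by fun_prop : Measurable fun o : Obs 𝒵 => g (o.1, o.2.1)).sub
      (h2.comp (measurable_snd.comp measurable_snd))))))
    ((measurable_covariance_condLaw Q hf hg).mul (measurable_integral_condLaw Q hs))

theorem measurable_absCov_condLaw (Q : ProbabilityMeasure (Obs 𝒵)) {f g : ℝ × ℝ → ℝ}
    (hf : Measurable f) (hg : Measurable g) :
    Measurable fun z => absCov f g (condLaw Q z) := by
  have h : StronglyMeasurable fun x : 𝒵 × ((ℝ × ℝ) × (ℝ × ℝ)) =>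
      |f x.2.1 - f x.2.2| * |g x.2.1 - g x.2.2| := Measurable.stronglyMeasurable (by fun_prop)
  have := (h.integral_kernel_prod_right' (κ := condLaw Q ×ₖ condLaw Q)).measurable
  simp only [Kernel.prod_apply] at this
  exact this

/-! ### Perturbations of a law -/

theorem abs_integral_sub_le {α : Type*} [MeasurableSpace α] {μ : Measure α} [IsProbabilityMeasure μ]
    {s p : α → ℝ} {B t δ : ℝ} (hs : Measurable s) (hp : Measurable p) (hB : ∀ x, |s x| ≤ B)
    (hδ : ∀ x, |p x - 1 - t * s x| ≤ δ) :
    |(∫ x, p x ∂μ) - 1 - t * ∫ x, s x ∂μ| ≤ δ := by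
  have hsi : Integrable s μ := Integrable.of_bound hs.aestronglyMeasurable B (ae_of_all _ hB)
  have hri : Integrable (fun x => p x - 1 - t * s x) μ :=
    Integrable.of_bound (by fun_prop) δ (ae_of_all _ hδ)
  have hli : Integrable (fun x => 1 + t * s x) μ := (integrable_const 1).add (hsi.const_mul t)
  have hpi : ∫ x, p x ∂μ = ∫ x, (p x - 1 - t * s x) ∂μ + (1 + t * ∫ x, s x ∂μ) := by
    have e : ∫ x, (1 + t * s x) ∂μ = 1 + t * ∫ x, s x ∂μ := by
      rw [integral_add (integrable_const 1) (hsi.const_mul t), integral_const_mul]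
      simp
    rw [← e, ← integral_add hri hli]
    exact integral_congr_ae (ae_of_all _ fun x => by ring)
  have h := norm_integral_le_of_norm_le_const (μ := μ) (f := fun x => p x - 1 - t * s x)
    (ae_of_all _ hδ)
  rw [probReal_univ, mul_one, Real.norm_eq_abs] at h
  rwa [hpi, show ∀ a b : ℝ, a + (1 + b) - 1 - b = a from fun a b => by ring]

/-- `Q` has a density `p` with respect to `P` within `δ` of `1 + t s`, where `|s| ≤ B`. -/
structure IsPerturbation {𝒪 : Type*} [MeasurableSpace 𝒪] (P Q : ProbabilityMeasure 𝒪)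
    (s p : 𝒪 → ℝ) (B t δ : ℝ) : Prop where
  measurable_score : Measurable s
  measurable_density : Measurable p
  score_le : ∀ o, |s o| ≤ B
  density_close : ∀ o, |p o - 1 - t * s o| ≤ δ
  small : |t| * B + δ ≤ 1 / 2
  eq_withDensity : (Q : Measure 𝒪) = (P : Measure 𝒪).withDensity fun o => ENNReal.ofReal (p o)

theorem IsPerturbation.density_bounds {𝒪 : Type*} [MeasurableSpace 𝒪] {P Q : ProbabilityMeasure 𝒪}
    {s p : 𝒪 → ℝ} {B t δ : ℝ} (h : IsPerturbation P Q s p B t δ) (o : 𝒪) :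
    1 / 2 ≤ p o ∧ p o ≤ 3 / 2 := by
  have h1 := abs_le.1 (h.density_close o)
  have h2 : |t * s o| ≤ |t| * B := by
    rw [abs_mul]; exact mul_le_mul_of_nonneg_left (h.score_le o) (abs_nonneg t)
  have h3 := abs_le.1 h2
  have := h.small
  constructor <;> linarith

/-- Trades almost sure bounds on the density for bounds at every point, so that they restrict to
every slice. The density may depend on `ε`; the score bound `B` does not. -/
theorem IsSubmodel.exists_isPerturbation {𝒪 : Type*} [MeasurableSpace 𝒪] {P : ProbabilityMeasure 𝒪}
    {s : 𝒪 → ℝ} {Q : ℝ → ProbabilityMeasure 𝒪} (h : IsSubmodel P s Q) :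
    ∃ B : ℝ, 0 ≤ B ∧ ∀ ε > 0, ∀ᶠ t in 𝓝 (0 : ℝ), ∃ p, IsPerturbation P (Q t) s p B t (ε * |t|) := by
  obtain ⟨hs, ⟨B, hB⟩, p, hp, -, hQ, hexp⟩ := h
  refine ⟨|B|, abs_nonneg B, fun ε hε => ?_⟩
  have hsmall : ∀ᶠ t in 𝓝 (0 : ℝ), |t| * |B| + ε * |t| < 1 / 2 := by
    have hc : Continuous fun t : ℝ => |t| * |B| + ε * |t| := by fun_prop
    exact hc.continuousAt.eventually_lt continuousAt_const (by simp)
  filter_upwards [hQ, hexp ε hε, hsmall] with t hQt het hst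
  have hm : MeasurableSet {o | |p t o - 1 - t * s o| ≤ ε * |t|} :=
    measurableSet_le (by have := hp t; fun_prop) measurable_const
  classical
  -- On the null set where the bound fails, the density is replaced by its linearization.
  refine ⟨fun o => if |p t o - 1 - t * s o| ≤ ε * |t| then p t o else 1 + t * s o, hs,
    Measurable.ite hm (hp t) (by fun_prop), fun o => (hB o).trans (le_abs_self B), fun o => ?_,
    hst.le, ?_⟩
  · split_ifs with ho
    · exact ho
    · rw [add_sub_cancel_left, sub_self, abs_zero]; positivity
  · rw [hQt]
    refine withDensity_congr_ae ?_
    filter_upwards [het] with o ho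
    rw [if_pos ho]

/-- The densities integrate to 1, so `|t| |E s| ≤ ε |t|` near 0; taking `ε = |E s| / 2` at some `t ≠
0` is contradictory. -/
theorem IsSubmodel.integral_score_eq_zero {𝒪 : Type*} [MeasurableSpace 𝒪] {P : ProbabilityMeasure 𝒪}
    {s : 𝒪 → ℝ} {Q : ℝ → ProbabilityMeasure 𝒪} (h : IsSubmodel P s Q) :
    ∫ o, s o ∂(P : Measure 𝒪) = 0 := by
  obtain ⟨B, -, hB⟩ := h.exists_isPerturbation
  by_contra hne
  have hpos : 0 < |∫ o, s o ∂(P : Measure 𝒪)| / 2 := by positivity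
  have hev := (hB _ hpos).filter_mono (nhdsWithin_le_nhds (s := {(0 : ℝ)}ᶜ))
  obtain ⟨t, ⟨p, hp⟩, ht⟩ := (hev.and self_mem_nhdsWithin).exists
  have h1 : ∫ o, p o ∂(P : Measure 𝒪) = 1 := by
    have := integral_withDensity_ofReal (μ := (P : Measure 𝒪)) (fun _ => 1)
      hp.measurable_density (fun o => by linarith [hp.density_bounds o])
    rw [← hp.eq_withDensity] at this
    simpa using this.symm
  have h3 := abs_integral_sub_le (μ := (P : Measure 𝒪)) hp.measurable_score hp.measurable_density
    hp.score_le hp.density_close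
  rw [h1, sub_self, zero_sub, abs_neg, abs_mul] at h3
  have ht0 : 0 < |t| := abs_pos.2 ht
  nlinarith [mul_pos hpos ht0]

namespace IsPerturbation

variable {P Q : ProbabilityMeasure (Obs 𝒵)} {s p : Obs 𝒵 → ℝ} {B t δ : ℝ}

theorem measurable_mass (h : IsPerturbation P Q s p B t δ) :
    Measurable fun z => ∫ a, slice p z a ∂(condLaw P z) :=
  measurable_integral_condLaw P h.measurable_density

theorem mass_bounds (h : IsPerturbation P Q s p B t δ) (z : 𝒵) :
    1 / 2 ≤ ∫ a, slice p z a ∂(condLaw P z) ∧ ∫ a, slice p z a ∂(condLaw P z) ≤ 3 / 2 :=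
  integral_mem_of_bounds (measurable_slice h.measurable_density z)
    (fun _ => (h.density_bounds _).1) fun _ => (h.density_bounds _).2

theorem ofReal_mass (h : IsPerturbation P Q s p B t δ) (z : 𝒵) :
    ENNReal.ofReal (∫ a, slice p z a ∂(condLaw P z)) =
      ∫⁻ a, ENNReal.ofReal (slice p z a) ∂(condLaw P z) := by
  refine ofReal_integral_eq_lintegral_ofReal (Integrable.of_bound
    (measurable_slice h.measurable_density z).aestronglyMeasurable (3 / 2)
    (ae_of_all _ fun a => abs_le.2 ⟨?_, (h.density_bounds _).2⟩))
    (ae_of_all _ fun a => ?_)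
  · linarith [(h.density_bounds (a.1, a.2, z)).1, show slice p z a = p (a.1, a.2, z) from rfl]
  · exact le_trans (by norm_num) (h.density_bounds _).1

theorem lawZ_eq (h : IsPerturbation P Q s p B t δ) :
    lawZ Q = (lawZ P).withDensity
      fun z => ENNReal.ofReal (∫ a, slice p z a ∂(condLaw P z)) := by
  have hp := h.measurable_density
  have hq := h.measurable_mass
  refine Measure.ext_of_lintegral _ fun F hF => ?_
  rw [lintegral_withDensity_eq_lintegral_mul _ (by fun_prop) hF, lawZ,
    lintegral_map hF (by fun_prop), h.eq_withDensity,
    lintegral_withDensity_eq_lintegral_mul _ (by fun_prop) (by fun_prop),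
    lintegral_obs P (by fun_prop)]
  refine lintegral_congr fun z => ?_
  simp only [Pi.mul_apply, h.ofReal_mass]
  rw [lintegral_mul_const _ (by fun_prop)]
  rfl

theorem lawZ_absolutelyContinuous (h : IsPerturbation P Q s p B t δ) : lawZ Q ≪ lawZ P := by
  rw [h.lawZ_eq]; exact withDensity_absolutelyContinuous _ _

/-- The mass is at least `1/2`, so both laws of `Z` have the same null sets. -/
theorem absolutelyContinuous_lawZ (h : IsPerturbation P Q s p B t δ) : lawZ P ≪ lawZ Q := by
  rw [h.lawZ_eq]
  refine withDensity_absolutelyContinuous' h.measurable_mass.ennreal_ofReal.aemeasurable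
    (ae_of_all _ fun z => ?_)
  exact (ENNReal.ofReal_pos.2 (by linarith [(h.mass_bounds z).1])).ne'

/-- By uniqueness of disintegration it suffices that the tilted kernel, composed with the new law of
`Z`, reproduces `Q`; the mass in the density of `Z` cancels the normalization of the tilt. -/
theorem condLaw_ae_eq (h : IsPerturbation P Q s p B t δ) :
    ∀ᵐ z ∂(lawZ P), condLaw Q z = tilt (condLaw P z) (slice p z) := by
  have hp := h.measurable_density
  have hq := h.measurable_mass
  let k : 𝒵 → (ℝ × ℝ) → ENNReal := fun z a =>
    ENNReal.ofReal (slice p z a / ∫ b, slice p z b ∂(condLaw P z))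
  have hk : Measurable (Function.uncurry k) := by
    have h1 : Measurable fun x : 𝒵 × (ℝ × ℝ) => p (x.2.1, x.2.2, x.1) := by fun_prop
    exact (h1.div (hq.comp measurable_fst)).ennreal_ofReal
  have hkz : ∀ z, (condLaw P).withDensity k z = tilt (condLaw P z) (slice p z) := fun z =>
    Kernel.withDensity_apply _ hk z
  have : IsMarkovKernel ((condLaw P).withDensity k) := ⟨fun z => by
    rw [hkz]
    exact isProbabilityMeasure_tilt (measurable_slice hp z) (fun _ => (h.density_bounds _).1)
      fun _ => (h.density_bounds _).2⟩
  have hae : condLaw Q =ᵐ[lawZ Q] (condLaw P).withDensity k := by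
    refine condDistrib_ae_eq_of_measure_eq_compProd _ (by fun_prop) ?_
    change _ = lawZ Q ⊗ₘ _
    refine Measure.ext_of_lintegral _ fun F hF => ?_
    rw [lintegral_map hF (by fun_prop), Measure.lintegral_compProd hF, h.eq_withDensity,
      lintegral_withDensity_eq_lintegral_mul _ (by fun_prop) (by fun_prop),
      lintegral_obs P (by fun_prop), h.lawZ_eq,
      lintegral_withDensity_eq_lintegral_mul _ (by fun_prop) (by fun_prop)]
    refine lintegral_congr fun z => ?_
    have hc : 0 < ∫ a, slice p z a ∂(condLaw P z) := by linarith [(h.mass_bounds z).1]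
    simp only [Pi.mul_apply]
    rw [Kernel.lintegral_withDensity _ hk z (by fun_prop), ← lintegral_const_mul]
    · refine lintegral_congr fun a => ?_
      rw [← mul_assoc, ← ENNReal.ofReal_mul hc.le, mul_div_cancel₀ _ hc.ne']
      rfl
    · have := measurable_slice hp z
      fun_prop
  filter_upwards [h.absolutelyContinuous_lawZ.ae_le hae] with z hz
  rw [hz, hkz]

theorem integral_lawZ (h : IsPerturbation P Q s p B t δ) (F : 𝒵 → ℝ) :
    ∫ z, F z ∂(lawZ Q) = ∫ z, (∫ a, slice p z a ∂(condLaw P z)) * F z ∂(lawZ P) := by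
  rw [h.lawZ_eq, integral_withDensity_ofReal _ h.measurable_mass
    fun z => by linarith [(h.mass_bounds z).1]]

theorem integrable_lawZ (h : IsPerturbation P Q s p B t δ) {F : 𝒵 → ℝ}
    (hF : Integrable F (lawZ P)) : Integrable F (lawZ Q) := by
  rw [h.lawZ_eq]
  exact integrable_withDensity_of_abs_le hF h.measurable_mass (B := 3 / 2) fun z =>
    abs_le.2 ⟨by linarith [(h.mass_bounds z).1], (h.mass_bounds z).2⟩

theorem abs_mass_sub_le (h : IsPerturbation P Q s p B t δ) (z : 𝒵) :
    |(∫ a, slice p z a ∂(condLaw P z)) - 1 - t * ∫ a, slice s z a ∂(condLaw P z)| ≤ δ :=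
  abs_integral_sub_le (measurable_slice h.measurable_score z)
    (measurable_slice h.measurable_density z) (fun _ => h.score_le _) fun _ => h.density_close _

end IsPerturbation

theorem abs_integral_slice_le (P : ProbabilityMeasure (Obs 𝒵)) {s : Obs 𝒵 → ℝ} {B : ℝ}
    (hB : ∀ o, |s o| ≤ B) (z : 𝒵) : |∫ a, slice s z a ∂(condLaw P z)| ≤ B := by
  simpa using norm_integral_le_of_norm_le_const (μ := condLaw P z) (f := slice s z)
    (ae_of_all _ fun a => hB (a.1, a.2, z))

/-! ### Uniqueness of influence functions -/

section Uniqueness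

variable {𝒪 : Type*} [MeasurableSpace 𝒪]

theorem exists_isSubmodel (P : ProbabilityMeasure 𝒪) {s : 𝒪 → ℝ} (hs : Measurable s) {B : ℝ}
    (hB : ∀ o, |s o| ≤ B) (h0 : ∫ o, s o ∂(P : Measure 𝒪) = 0) :
    ∃ Q : ℝ → ProbabilityMeasure 𝒪, IsSubmodel P s Q := by
  have hsi : Integrable s (P : Measure 𝒪) :=
    Integrable.of_bound hs.aestronglyMeasurable B (ae_of_all _ hB)
  have hpos : ∀ t : ℝ, |t| * B < 1 → ∀ o, 0 ≤ 1 + t * s o := fun t ht o => by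
    have h1 : |t * s o| ≤ |t| * B := by
      rw [abs_mul]; exact mul_le_mul_of_nonneg_left (hB o) (abs_nonneg t)
    linarith [(abs_le.1 h1).1]
  have hprob : ∀ t : ℝ, |t| * B < 1 → IsProbabilityMeasure
      ((P : Measure 𝒪).withDensity fun o => ENNReal.ofReal (1 + t * s o)) := fun t ht => by
    have hi : Integrable (fun o => 1 + t * s o) (P : Measure 𝒪) :=
      (integrable_const 1).add (hsi.const_mul t)
    constructor
    rw [withDensity_apply _ MeasurableSet.univ, setLIntegral_univ,
      ← ofReal_integral_eq_lintegral_ofReal hi (ae_of_all _ (hpos t ht)),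
      integral_add (integrable_const 1) (hsi.const_mul t), integral_const_mul, h0]
    simp
  have hsmall : ∀ᶠ t in 𝓝 (0 : ℝ), |t| * B < 1 := by
    have hc : Continuous fun t : ℝ => |t| * B := by fun_prop
    exact hc.continuousAt.eventually_lt continuousAt_const (by simp)
  have hex : ∀ t : ℝ, ∃ Q : ProbabilityMeasure 𝒪, |t| * B < 1 → (Q : Measure 𝒪) =
      (P : Measure 𝒪).withDensity fun o => ENNReal.ofReal (1 + t * s o) := fun t => by
    by_cases ht : |t| * B < 1
    · exact ⟨⟨_, hprob t ht⟩, fun _ => rfl⟩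
    -- Away from 0 the family is arbitrary, since a submodel is constrained only near 0.
    · exact ⟨P, fun h => absurd h ht⟩
  choose Q hQ using hex
  refine ⟨Q, hs, ⟨B, hB⟩,
    fun t o => max (1 + t * s o) 0, fun t => by fun_prop, fun t o => le_max_right _ _, ?_, ?_⟩
  · filter_upwards [hsmall] with t ht
    simp only [max_eq_left (hpos t ht _), hQ t ht]
  · intro ε hε
    filter_upwards [hsmall] with t ht
    refine ae_of_all _ fun o => ?_
    rw [max_eq_left (hpos t ht o), add_sub_cancel_left, sub_self, abs_zero]
    positivity

theorem IsInfluenceFunction.ae_eq {M : Set (ProbabilityMeasure 𝒪)} {Ψ : ProbabilityMeasure 𝒪 → ℝ}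
    {P : ProbabilityMeasure 𝒪} {φ φ' : 𝒪 → ℝ} (h : IsInfluenceFunction M Ψ P φ)
    (h' : IsInfluenceFunction M Ψ P φ') : φ' =ᵐ[(P : Measure 𝒪)] φ := by
  have hi : Integrable φ (P : Measure 𝒪) := h.1.integrable one_le_two
  have hi' : Integrable φ' (P : Measure 𝒪) := h'.1.integrable one_le_two
  refine hi'.ae_eq_of_forall_setIntegral_eq _ _ hi fun A hA _ => ?_
  set c := (P : Measure 𝒪).real A with hc
  -- The centred indicator is a bounded score, and `E(ψ s)` is the integral of `ψ` over `A` whenever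
  -- `ψ` has mean zero.
  let s : 𝒪 → ℝ := fun o => A.indicator 1 o - c
  have hs : Measurable s := (measurable_one.indicator hA).sub measurable_const
  have hs0 : ∫ o, s o ∂(P : Measure 𝒪) = 0 := by
    have : Integrable (A.indicator (1 : 𝒪 → ℝ)) (P : Measure 𝒪) :=
      (integrable_const (1 : ℝ)).indicator hA
    rw [integral_sub this (integrable_const c), integral_indicator_one hA]
    simp [hc]
  have hsB : ∀ o, |s o| ≤ 1 + |c| := fun o => by
    refine (abs_sub _ _).trans (add_le_add ?_ le_rfl)
    by_cases ho : o ∈ A <;> simp [ho]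
  obtain ⟨Q, hQ⟩ := exists_isSubmodel P hs hsB hs0
  have key : ∀ ψ : 𝒪 → ℝ, IsInfluenceFunction M Ψ P ψ → Integrable ψ (P : Measure 𝒪) →
      ∫ o, ψ o * s o ∂(P : Measure 𝒪) = ∫ o in A, ψ o ∂(P : Measure 𝒪) := fun ψ hψ hψi => by
    have e : ∀ o, ψ o * s o = A.indicator ψ o - ψ o * c := fun o => by
      by_cases ho : o ∈ A <;> simp [s, ho, mul_sub]
    simp only [e]
    rw [integral_sub (hψi.indicator hA) (hψi.mul_const c), integral_indicator hA,
      integral_mul_const, hψ.2.1, zero_mul, sub_zero]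
  rw [← key φ h hi, ← key φ' h' hi']
  exact (h'.2.2 s Q hQ).2.unique (h.2.2 s Q hQ).2

/-- At `t = 0` the permitted error `ε |t|` is zero, so the density is exactly 1. -/
theorem IsSubmodel.apply_zero {P : ProbabilityMeasure 𝒪} {s : 𝒪 → ℝ} {Q : ℝ → ProbabilityMeasure 𝒪}
    (h : IsSubmodel P s Q) : Q 0 = P := by
  obtain ⟨B, -, hB⟩ := h.exists_isPerturbation
  obtain ⟨p, hp⟩ := (hB 1 one_pos).self_of_nhds
  have h1 : ∀ o, p o = 1 := fun o => by
    have := hp.density_close o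
    rw [abs_zero, mul_zero, zero_mul, sub_zero] at this
    exact sub_eq_zero.1 (abs_nonpos_iff.1 this)
  apply Subtype.ext
  have := hp.eq_withDensity
  simp only [h1, ENNReal.ofReal_one] at this
  exact this.trans withDensity_one

end Uniqueness

/-! ### Differentiation of integrals and quotients with uniform remainders -/

/-- Differentiation under the integral from a remainder uniform relative to `H`. The representing
integrand `F` may change with `ε` and `t`, as the density of a perturbation does. -/
theorem hasDerivAt_integral_of_remainder_le {α : Type*} [MeasurableSpace α] {μ : Measure α}
    {Ψ : ℝ → ℝ} {F₀ F' H : α → ℝ} (hF₀ : Integrable F₀ μ) (hF' : Integrable F' μ)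
    (hH : Integrable H μ) (hH0 : 0 ≤ H)
    (h : ∀ ε > 0, ∀ᶠ t in 𝓝 (0 : ℝ), ∃ F : α → ℝ, AEStronglyMeasurable F μ ∧ Ψ t = ∫ x, F x ∂μ ∧
      ∀ᵐ x ∂μ, |F x - F₀ x - t * F' x| ≤ ε * |t| * H x) :
    HasDerivAt Ψ (∫ x, F' x ∂μ) 0 := by
  have key : ∀ ε > 0, ∀ᶠ t in 𝓝 (0 : ℝ),
      |Ψ t - ∫ x, F₀ x ∂μ - t * ∫ x, F' x ∂μ| ≤ ε * |t| * ∫ x, H x ∂μ := fun ε hε => by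
    filter_upwards [h ε hε] with t ⟨F, hFm, hΨ, hF⟩
    have hRi : Integrable (fun x => F x - F₀ x - t * F' x) μ :=
      (hH.const_mul (ε * |t|)).mono' ((hFm.sub hF₀.1).sub (hF'.const_mul t).1) hF
    have hlin : Integrable (fun x => F₀ x + t * F' x) μ := hF₀.add (hF'.const_mul t)
    have e : ∫ x, F x ∂μ = ∫ x, (F x - F₀ x - t * F' x) ∂μ +
        (∫ x, F₀ x ∂μ + t * ∫ x, F' x ∂μ) := by
      rw [← integral_const_mul, ← integral_add hF₀ (hF'.const_mul t), ← integral_add hRi hlin]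
      exact integral_congr_ae (ae_of_all _ fun x => by ring)
    rw [hΨ, e, show ∀ a b c : ℝ, a + (b + c) - b - c = a from fun a b c => by ring,
      ← integral_const_mul, ← Real.norm_eq_abs]
    exact norm_integral_le_of_norm_le (hH.const_mul _) hF
  have h0 : Ψ 0 = ∫ x, F₀ x ∂μ := by
    have := (key 1 one_pos).self_of_nhds
    simp only [abs_zero, mul_zero, zero_mul, sub_zero] at this
    exact sub_eq_zero.1 (abs_nonpos_iff.1 this)
  have hHI : 0 ≤ ∫ x, H x ∂μ := integral_nonneg hH0
  rw [hasDerivAt_iff_isLittleO, Asymptotics.isLittleO_iff]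
  intro c hc
  -- The `+ 1` guards against a zero integral of `H`.
  filter_upwards [key (c / (∫ x, H x ∂μ + 1)) (by positivity)] with t ht
  rw [sub_zero, h0, smul_eq_mul, Real.norm_eq_abs, Real.norm_eq_abs]
  refine ht.trans ?_
  rw [div_mul_eq_mul_div, div_mul_eq_mul_div, div_le_iff₀ (by positivity)]
  have : 0 ≤ c * |t| := by positivity
  nlinarith

theorem half_le_of_abs_sub_le {e E L η t : ℝ} (he : |e| ≤ L) (hE : |E - 1 - t * e| ≤ η * |t|)
    (htL : |t| * L ≤ 1 / 4) (htη : η * |t| ≤ 1 / 4) : 1 / 2 ≤ E := by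
  have h1 : |t * e| ≤ |t| * L := by
    rw [abs_mul]; exact mul_le_mul_of_nonneg_left he (abs_nonneg t)
  linarith [(abs_le.1 hE).1, (abs_le.1 h1).1]

/-- First-order expansion of `A S / E` around `t = 0`, where `A ≈ a + t d`, `S ≈ 1 + t r` and
`E ≈ 1 + t e`. -/
theorem abs_mul_div_sub_le {a d A e E r S G L η t : ℝ} (hG : 0 ≤ G) (hL : 0 ≤ L) (hη : 0 ≤ η)
    (ha : |a| ≤ G) (hd : |d| ≤ L * G) (he : |e| ≤ L) (hr : |r| ≤ L)
    (hA : |A - a - t * d| ≤ η * |t| * G) (hE : |E - 1 - t * e| ≤ η * |t|)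
    (hS : |S - 1 - t * r| ≤ η * |t|) (htL : |t| * L ≤ 1 / 4) (htη : η * |t| ≤ 1 / 4) :
    |A * S / E - a - t * (d + a * r - a * e)| ≤ (8 * (|t| * L ^ 2) + 10 * η) * |t| * G := by
  have hE2 := half_le_of_abs_sub_le he hE htL htη
  have hE0 : 0 < E := by linarith
  have ht0 := abs_nonneg t
  have hD : |d + a * r - a * e| ≤ 3 * L * G := by
    have h1 : |a * r| ≤ G * L := by
      rw [abs_mul]; exact mul_le_mul ha hr (abs_nonneg _) hG
    have h2 : |a * e| ≤ G * L := by
      rw [abs_mul]; exact mul_le_mul ha he (abs_nonneg _) hG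
    have := abs_le.1 h1
    have := abs_le.1 h2
    have := abs_le.1 hd
    exact abs_le.2 ⟨by linarith, by linarith⟩
  have hS2 : |S| ≤ 3 / 2 := by
    have h1 : |t * r| ≤ |t| * L := by
      rw [abs_mul]; exact mul_le_mul_of_nonneg_left hr ht0
    have := abs_le.1 hS
    have := abs_le.1 h1
    exact abs_le.2 ⟨by linarith, by linarith⟩
  have e1 : A * S / E - a - t * (d + a * r - a * e) =
      (A * S - (a + t * (d + a * r - a * e)) * E) / E := by
    field_simp
    ring
  -- The three remainder terms cost `3/2 + 5/4 + 7/4 ≤ 5` multiples of `η |t| G`, and the two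
  -- quadratic terms cost `1 + 3 = 4` multiples of `t² L² G`. Dividing by `E ≥ 1/2` doubles them to
  -- 10 and 8.
  have e2 : A * S - (a + t * (d + a * r - a * e)) * E =
      (A - a - t * d) * S + (a + t * d) * (S - 1 - t * r) + t ^ 2 * (d * r)
        - t ^ 2 * (e * (d + a * r - a * e))
        - (a + t * (d + a * r - a * e)) * (E - 1 - t * e) := by ring
  have b1 : |(A - a - t * d) * S| ≤ η * |t| * G * (3 / 2) := by
    rw [abs_mul]; exact mul_le_mul hA hS2 (abs_nonneg _) (by positivity)
  have b2 : |(a + t * d) * (S - 1 - t * r)| ≤ (5 / 4 * G) * (η * |t|) := by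
    rw [abs_mul]
    refine mul_le_mul ?_ hS (abs_nonneg _) (by positivity)
    refine (abs_add_le _ _).trans ?_
    rw [abs_mul]
    have := mul_le_mul_of_nonneg_left hd ht0
    have := mul_le_mul_of_nonneg_right htL hG
    linarith
  have b3 : |t ^ 2 * (d * r)| ≤ |t| ^ 2 * (L * G * L) := by
    rw [abs_mul, abs_pow, abs_mul]
    exact mul_le_mul_of_nonneg_left (mul_le_mul hd hr (abs_nonneg _) (by positivity))
      (by positivity)
  have b4 : |t ^ 2 * (e * (d + a * r - a * e))| ≤ |t| ^ 2 * (L * (3 * L * G)) := by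
    rw [abs_mul, abs_pow, abs_mul]
    exact mul_le_mul_of_nonneg_left (mul_le_mul he hD (abs_nonneg _) (by positivity))
      (by positivity)
  have b5 : |(a + t * (d + a * r - a * e)) * (E - 1 - t * e)| ≤ (7 / 4 * G) * (η * |t|) := by
    rw [abs_mul]
    refine mul_le_mul ?_ hE (abs_nonneg _) (by positivity)
    refine (abs_add_le _ _).trans ?_
    rw [abs_mul]
    have := mul_le_mul_of_nonneg_left hD ht0
    have := mul_le_mul_of_nonneg_right htL hG
    linarith
  have hη0 : 0 ≤ η * |t| * G := by positivity
  rw [e1, abs_div, abs_of_pos hE0, div_le_iff₀ hE0, e2]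
  have hsum : |(A - a - t * d) * S + (a + t * d) * (S - 1 - t * r) + t ^ 2 * (d * r)
        - t ^ 2 * (e * (d + a * r - a * e))
        - (a + t * (d + a * r - a * e)) * (E - 1 - t * e)| ≤
      (8 * (|t| * L ^ 2) + 10 * η) * |t| * G * (1 / 2) := by
    have := abs_le.1 b1
    have := abs_le.1 b2
    have := abs_le.1 b3
    have := abs_le.1 b4
    have := abs_le.1 b5
    exact abs_le.2 ⟨by linarith, by linarith⟩
  exact hsum.trans (mul_le_mul_of_nonneg_left hE2 (by positivity))

/-- These are the smallness conditions of `abs_mul_div_sub_le` for `L = B M` and `η = M (|t| B² + 4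
ε')`, together with a final error of at most `ε`. -/
theorem exists_eventually_small (B : ℝ) {M ε : ℝ} (hM : 1 ≤ M) (hε : 0 < ε) :
    ∃ ε' > 0, ∀ᶠ t in 𝓝 (0 : ℝ), |t| * (B * M) ≤ 1 / 4 ∧
      M * (|t| * B ^ 2 + 4 * ε') * |t| ≤ 1 / 4 ∧
      8 * (|t| * (B * M) ^ 2) + 10 * (M * (|t| * B ^ 2 + 4 * ε')) ≤ ε := by
  have hM0 : 0 < M := by linarith
  -- The term that survives at `t = 0` is `10 · M · 4ε' = ε / 2`.
  refine ⟨ε / (80 * M), by positivity, ?_⟩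
  have c1 : Continuous fun t : ℝ => |t| * (B * M) := by fun_prop
  have c2 : Continuous fun t : ℝ => M * (|t| * B ^ 2 + 4 * (ε / (80 * M))) * |t| := by fun_prop
  have c3 : Continuous fun t : ℝ => 8 * (|t| * (B * M) ^ 2) +
    10 * (M * (|t| * B ^ 2 + 4 * (ε / (80 * M)))) := by fun_prop
  have e1 := c1.continuousAt (x := 0) |>.eventually_lt (continuousAt_const (y := (1 / 4 : ℝ)))
    (by simp)
  have e2 := c2.continuousAt (x := 0) |>.eventually_lt (continuousAt_const (y := (1 / 4 : ℝ)))
    (by simp)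
  have e3 := c3.continuousAt (x := 0) |>.eventually_lt (continuousAt_const (y := ε)) (by
    have : 10 * (M * (4 * (ε / (80 * M)))) = ε / 2 := by field_simp; norm_num
    simp only [abs_zero, zero_mul, mul_zero, zero_add]
    linarith)
  filter_upwards [e1, e2, e3] with t h1 h2 h3 using ⟨h1.le, h2.le, h3.le⟩

/-! ### Estimating equations -/

section Estimators

variable {𝒵 : Type*} (v : ℝ → ℝ)

theorem mean_icLambda_eq_zero_iff (w ρ β m π lam : 𝒵 → ℝ) {n : ℕ} (hn : 0 < n)
    (o : Fin n → Obs 𝒵) (θ : ℝ) :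
    (n : ℝ)⁻¹ * ∑ i, icLambda v w ρ β m π lam θ (o i) = 0 ↔
      θ = lambdaHat v w ρ β m π lam o := by
  have hn' : (n : ℝ) ≠ 0 := by positivity
  have e : (n : ℝ)⁻¹ * ∑ i, icLambda v w ρ β m π lam θ (o i) =
      lambdaHat v w ρ β m π lam o - θ := by
    simp only [icLambda, lambdaHat, contrast, Finset.sum_sub_distrib, Finset.sum_const,
      Finset.card_univ, Fintype.card_fin, nsmul_eq_mul, mul_sub, ← sub_sub]
    rw [← mul_assoc, inv_mul_cancel₀ hn', one_mul]
  rw [e, sub_eq_zero, eq_comm]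

/-- The fitted `β` in the weight cancels the one in the contrast, leaving an equation affine in `θ`
with the common factor `1 / c`. -/
theorem mean_icLambdaBar_eq_zero_iff (ρ β m π : 𝒵 → ℝ) {c : ℝ} (hc : c ≠ 0) {n : ℕ}
    (o : Fin n → Obs 𝒵) (hβ : ∀ i, β (o i).2.2 ≠ 0)
    (hne : ∑ i, (v (o i).2.1 - ρ (o i).2.2) * ((o i).2.1 - π (o i).2.2) ≠ 0) (θ : ℝ) :
    (n : ℝ)⁻¹ * ∑ i, icLambdaBar v (fun z => β z / c) ρ β m π θ (o i) = 0 ↔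
      θ = lambdaBarHat v ρ m π o := by
  have hn' : (n : ℝ) ≠ 0 := by
    rintro h
    obtain rfl : n = 0 := by exact_mod_cast h
    simp at hne
  have e : ∑ i, icLambdaBar v (fun z => β z / c) ρ β m π θ (o i) =
      (∑ i, (v (o i).2.1 - ρ (o i).2.2) * ((o i).1 - m (o i).2.2) -
        θ * ∑ i, (v (o i).2.1 - ρ (o i).2.2) * ((o i).2.1 - π (o i).2.2)) / c := by
    rw [Finset.mul_sum, ← Finset.sum_sub_distrib, Finset.sum_div]
    refine Finset.sum_congr rfl fun i _ => ?_
    have := hβ i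
    simp only [icLambdaBar, contrast]
    field_simp
    ring
  rw [e, lambdaBarHat, eq_div_iff hne, mul_eq_zero, div_eq_zero_iff, sub_eq_zero]
  simp only [inv_eq_zero, hn', hc, false_or, or_false]
  exact eq_comm

end Estimators

/-! ### Conditional covariances along a submodel -/

theorem IsPerturbation.ae_covariance {P Q : ProbabilityMeasure (Obs 𝒵)} {s p : Obs 𝒵 → ℝ}
    {B t δ : ℝ} (h : IsPerturbation P Q s p B t δ) {f g : ℝ × ℝ → ℝ}
    (hfg : ∀ᵐ z ∂(lawZ P), CovExists f g (condLaw P z)) :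
    ∀ᵐ z ∂(lawZ P), CovExists f g (condLaw Q z) ∧
      covariance f g (condLaw Q z) =
        tiltCov f g (slice p z) (condLaw P z) / (∫ a, slice p z a ∂(condLaw P z)) ^ 2 ∧
      absCov f g (condLaw Q z) ≤ 9 * absCov f g (condLaw P z) ∧
      |tiltCov f g (slice p z) (condLaw P z) - covariance f g (condLaw P z) -
        t * covDeriv f g (slice s z) (condLaw P z)| ≤
          (t ^ 2 * B ^ 2 + 4 * δ) * absCov f g (condLaw P z) := by
  filter_upwards [hfg, h.condLaw_ae_eq] with z hz hQ
  have hp := measurable_slice h.measurable_density z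
  have h1 : ∀ a, 1 / 2 ≤ slice p z a := fun _ => (h.density_bounds _).1
  have h2 : ∀ a, slice p z a ≤ 3 / 2 := fun _ => (h.density_bounds _).2
  rw [hQ]
  exact ⟨hz.tilt hp h1 h2, hz.covariance_tilt hp h1 h2, hz.absCov_tilt_le hp h1 h2,
    hz.abs_tiltCov_sub_le (measurable_slice h.measurable_score z) hp (fun _ => h.score_le _)
      (fun _ => h.density_close _) h.small⟩

theorem IsPerturbation.condCovExist {P Q : ProbabilityMeasure (Obs 𝒵)} {s p : Obs 𝒵 → ℝ}
    {B t δ : ℝ} (h : IsPerturbation P Q s p B t δ) {v : ℝ → ℝ} (hP : CondCovExist v P) :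
    CondCovExist v Q := by
  refine h.lawZ_absolutelyContinuous.ae_le ?_
  filter_upwards [h.ae_covariance (hP.mono fun _ hz => hz.1),
    h.ae_covariance (hP.mono fun _ hz => hz.2)] with z h1 h2 using ⟨h1.1, h2.1⟩

theorem integrable_covariance (P : ProbabilityMeasure (Obs 𝒵)) {f g : ℝ × ℝ → ℝ}
    (hf : Measurable f) (hg : Measurable g)
    (hfg : ∀ᵐ z ∂(lawZ P), CovExists f g (condLaw P z))
    (hint : Integrable (fun z => absCov f g (condLaw P z)) (lawZ P)) :
    Integrable (fun z => covariance f g (condLaw P z)) (lawZ P) := by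
  refine hint.mono' (measurable_covariance_condLaw P hf hg).aestronglyMeasurable ?_
  filter_upwards [hfg] with z hz
  have := hz.abs_covariance_le
  rw [Real.norm_eq_abs]
  linarith [abs_nonneg (covariance f g (condLaw P z))]

theorem integrable_covDeriv_sub (P : ProbabilityMeasure (Obs 𝒵)) {f g : ℝ × ℝ → ℝ}
    (hf : Measurable f) (hg : Measurable g) {s : Obs 𝒵 → ℝ} (hs : Measurable s) {B : ℝ}
    (hB : ∀ o, |s o| ≤ B) (hfg : ∀ᵐ z ∂(lawZ P), CovExists f g (condLaw P z))
    (hint : Integrable (fun z => absCov f g (condLaw P z)) (lawZ P)) :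
    Integrable (fun z => covDeriv f g (slice s z) (condLaw P z) -
      covariance f g (condLaw P z) * ∫ a, slice s z a ∂(condLaw P z)) (lawZ P) := by
  refine Integrable.sub ?_ (integrable_mul_of_abs_le (integrable_covariance P hf hg hfg hint)
    (measurable_integral_condLaw P hs) (abs_integral_slice_le P hB))
  refine (hint.const_mul B).mono' (measurable_covDeriv_condLaw P hf hg hs).aestronglyMeasurable ?_
  filter_upwards [hfg] with z hz
  exact hz.abs_covDeriv_le (measurable_slice hs z) fun _ => hB _

/-- The derivative of the mean conditional covariance along a submodel. -/
theorem IsSubmodel.hasDerivAt_integral_covariance {P : ProbabilityMeasure (Obs 𝒵)}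
    {s : Obs 𝒵 → ℝ} {Q : ℝ → ProbabilityMeasure (Obs 𝒵)} (h : IsSubmodel P s Q)
    {f g : ℝ × ℝ → ℝ} (hf : Measurable f) (hg : Measurable g)
    (hfg : ∀ᵐ z ∂(lawZ P), CovExists f g (condLaw P z))
    (hint : Integrable (fun z => absCov f g (condLaw P z)) (lawZ P)) :
    HasDerivAt (fun t => ∫ z, covariance f g (condLaw (Q t) z) ∂(lawZ (Q t)))
      (∫ z, (covDeriv f g (slice s z) (condLaw P z) -
        covariance f g (condLaw P z) * ∫ a, slice s z a ∂(condLaw P z)) ∂(lawZ P)) 0 := by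
  have hs := h.1
  obtain ⟨B, hB0, hB⟩ := h.exists_isPerturbation
  -- Used only to extract `|s| ≤ B` for this same `B`.
  obtain ⟨p₁, hp₁⟩ := (hB 1 one_pos).self_of_nhds
  refine hasDerivAt_integral_of_remainder_le (integrable_covariance P hf hg hfg hint)
    (integrable_covDeriv_sub P hf hg hs hp₁.score_le hfg hint) hint
    (fun z => absCov_nonneg _ _ _) fun ε hε => ?_
  obtain ⟨ε', hε', hsmall⟩ := exists_eventually_small B le_rfl hε
  filter_upwards [hB ε' hε', hsmall] with t ⟨p, hp⟩ ⟨s1, s2, s3⟩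
  refine ⟨fun z => (∫ a, slice p z a ∂(condLaw P z)) * covariance f g (condLaw (Q t) z),
    (hp.measurable_mass.mul (measurable_covariance_condLaw _ hf hg)).aestronglyMeasurable,
    hp.integral_lawZ _, ?_⟩
  filter_upwards [hfg, hp.ae_covariance hfg] with z hz ⟨_, hc, _, hr⟩
  have hm0 : (∫ a, slice p z a ∂(condLaw P z)) ≠ 0 := by linarith [(hp.mass_bounds z).1]
  have hG := absCov_nonneg f g (condLaw P z)
  have hη : 0 ≤ 1 * (|t| * B ^ 2 + 4 * ε') := by positivity
  -- The density of `Z` cancels one of the two masses in the normalization, so `S = 1` and `E` is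
  -- the mass.
  have key := abs_mul_div_sub_le (a := covariance f g (condLaw P z))
    (d := covDeriv f g (slice s z) (condLaw P z)) (A := tiltCov f g (slice p z) (condLaw P z))
    (e := ∫ a, slice s z a ∂(condLaw P z)) (E := ∫ a, slice p z a ∂(condLaw P z)) (r := 0)
    (S := 1) (G := absCov f g (condLaw P z)) (L := B * 1) (η := 1 * (|t| * B ^ 2 + 4 * ε')) (t := t)
    hG (by linarith) hη
    (by linarith [hz.abs_covariance_le, abs_nonneg (covariance f g (condLaw P z))])
    (by rw [mul_one]; exact hz.abs_covDeriv_le (measurable_slice hs z) fun _ => hp.score_le _)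
    (by rw [mul_one]; exact abs_integral_slice_le P hp.score_le z)
    (by rw [abs_zero]; linarith)
    (by
      refine hr.trans (le_of_eq ?_)
      rw [← sq_abs t]; ring)
    ((hp.abs_mass_sub_le z).trans (mul_le_mul_of_nonneg_right
      (by nlinarith [mul_nonneg (abs_nonneg t) (sq_nonneg B)]) (abs_nonneg t)))
    (by
      rw [sub_self, mul_zero, sub_zero, abs_zero]
      exact mul_nonneg hη (abs_nonneg t))
    s1 s2
  have e1 : (∫ a, slice p z a ∂(condLaw P z)) * covariance f g (condLaw (Q t) z) =
      tiltCov f g (slice p z) (condLaw P z) * 1 / ∫ a, slice p z a ∂(condLaw P z) := by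
    rw [hc]
    field_simp
  rw [e1]
  rw [mul_zero, add_zero] at key
  exact key.trans (mul_le_mul_of_nonneg_right
    (mul_le_mul_of_nonneg_right s3 (abs_nonneg t)) hG)

/-! ### The covariance-weighted effect -/

theorem covDeriv_one {ν : Measure (ℝ × ℝ)} [IsProbabilityMeasure ν] (f g : ℝ × ℝ → ℝ) :
    covDeriv f g (fun _ => 1) ν = 2 * covariance f g ν := by
  simp [covDeriv, covariance, two_mul]

theorem CovExists.integrable_score_mul {ν : Measure (ℝ × ℝ)} [IsProbabilityMeasure ν]
    {f g σ : ℝ × ℝ → ℝ} (hfg : CovExists f g ν) (hσ : Measurable σ) {B : ℝ}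
    (hB : ∀ x, |σ x| ≤ B) (a b : ℝ) : Integrable (fun x => σ x * ((f x - a) * (g x - b))) ν :=
  (integrable_mul_of_abs_le (hfg.integrable_centered a b) hσ hB).congr
    (ae_of_all _ fun _ => mul_comm _ _)

/-- Given `z`, the weight cancels `β` in the contrast. The subtracted covariance times the mean of
`s` removes the second term of `covDeriv`, leaving integrals of `s` times centred products. Any
bounded `s` is allowed, so that `s = 1` yields the mean of the curve. -/
theorem integral_phiLambdaBar_mul {v : ℝ → ℝ} {P : ProbabilityMeasure (Obs 𝒵)}
    (hv : Measurable v) (hP : P ∈ lambdaBarModel v) (hβ : ∀ᵐ z ∂(lawZ P), covVX v P z ≠ 0)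
    (hφ : MemLp (phiLambdaBar v P) 2 (P : Measure (Obs 𝒵))) {s : Obs 𝒵 → ℝ} (hs : Measurable s)
    {B : ℝ} (hB : ∀ o, |s o| ≤ B) :
    ∫ o, phiLambdaBar v P o * s o ∂(P : Measure (Obs 𝒵)) =
      ((∫ z, (covDeriv (fun a => v a.2) (fun a => a.1) (slice s z) (condLaw P z) -
        covVY v P z * ∫ a, slice s z a ∂(condLaw P z)) ∂(lawZ P)) -
      lambdaBarEstimand v P *
        ∫ z, (covDeriv (fun a => v a.2) (fun a => a.2) (slice s z) (condLaw P z) -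
        covVX v P z * ∫ a, slice s z a ∂(condLaw P z)) ∂(lawZ P)) /
      ∫ z, covVX v P z ∂(lawZ P) := by
  obtain ⟨hcov, hy, hx, -⟩ := hP
  have hiy : Integrable (fun z => covDeriv (fun a => v a.2) (fun a => a.1) (slice s z) (condLaw P z) -
      covVY v P z * ∫ a, slice s z a ∂(condLaw P z)) (lawZ P) :=
    integrable_covDeriv_sub P (by fun_prop) (by fun_prop) hs hB (hcov.mono fun _ hz => hz.1) hy
  have hix : Integrable (fun z => covDeriv (fun a => v a.2) (fun a => a.2) (slice s z) (condLaw P z) -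
      covVX v P z * ∫ a, slice s z a ∂(condLaw P z)) (lawZ P) :=
    integrable_covDeriv_sub P (by fun_prop) (by fun_prop) hs hB (hcov.mono fun _ hz => hz.2) hx
  rw [integral_obs P (integrable_mul_of_abs_le (hφ.integrable one_le_two) hs hB),
    ← integral_const_mul, ← integral_sub hiy (hix.const_mul _), ← integral_div]
  refine integral_congr_ae ?_
  filter_upwards [hcov, hβ] with z ⟨hzy, hzx⟩ hzβ
  have hσ := measurable_slice hs z
  have hσB : ∀ a, |slice s z a| ≤ B := fun _ => hB _
  have i1 := hzy.integrable_score_mul hσ hσB (∫ a, v a.2 ∂(condLaw P z)) (∫ a, a.1 ∂(condLaw P z))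
  have i2 := hzx.integrable_score_mul hσ hσB (∫ a, v a.2 ∂(condLaw P z)) (∫ a, a.2 ∂(condLaw P z))
  simp only [covDeriv]
  change _ = (_ + covVY v P z * _ - _ - _ * (_ + covVX v P z * _ - _)) / _
  rw [add_sub_cancel_right, add_sub_cancel_right, ← integral_const_mul,
    ← integral_sub i1 (i2.const_mul _), ← integral_div]
  refine integral_congr_ae (ae_of_all _ fun a => ?_)
  simp only [slice, phiLambdaBar, icLambdaBar, contrast, covWeight, outcomeMean, exposureMean,
    vMean]
  rw [div_mul_div_comm, mul_comm (∫ z', covVX v P z' ∂lawZ P) (covVX v P z),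
    mul_div_mul_left _ _ hzβ]
  ring

theorem covariance_weighted_effect {v : ℝ → ℝ} {P : ProbabilityMeasure (Obs 𝒵)}
    (hβ : ∀ᵐ z ∂(lawZ P), covVX v P z ≠ 0) :
    lambdaBarEstimand v P = ∫ z, covWeight v P z * condEffect v P z ∂(lawZ P) := by
  rw [lambdaBarEstimand, ← integral_div]
  refine integral_congr_ae ?_
  filter_upwards [hβ] with z hz
  simp only [covWeight, condEffect]
  rw [div_mul_div_comm, mul_comm (∫ z', covVX v P z' ∂lawZ P) (covVX v P z),
    mul_div_mul_left _ _ hz]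

theorem IsSubmodel.hasDerivAt_integral_covVY {v : ℝ → ℝ} {P : ProbabilityMeasure (Obs 𝒵)}
    {s : Obs 𝒵 → ℝ} {Q : ℝ → ProbabilityMeasure (Obs 𝒵)} (h : IsSubmodel P s Q) (hv : Measurable v)
    (hP : P ∈ lambdaBarModel v) :
    HasDerivAt (fun t => ∫ z, covVY v (Q t) z ∂(lawZ (Q t)))
      (∫ z, (covDeriv (fun a => v a.2) (fun a => a.1) (slice s z) (condLaw P z) -
        covVY v P z * ∫ a, slice s z a ∂(condLaw P z)) ∂(lawZ P)) 0 :=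
  h.hasDerivAt_integral_covariance (by fun_prop) (by fun_prop) (hP.1.mono fun _ hz => hz.1) hP.2.1

theorem IsSubmodel.hasDerivAt_integral_covVX {v : ℝ → ℝ} {P : ProbabilityMeasure (Obs 𝒵)}
    {s : Obs 𝒵 → ℝ} {Q : ℝ → ProbabilityMeasure (Obs 𝒵)} (h : IsSubmodel P s Q) (hv : Measurable v)
    (hP : P ∈ lambdaBarModel v) :
    HasDerivAt (fun t => ∫ z, covVX v (Q t) z ∂(lawZ (Q t)))
      (∫ z, (covDeriv (fun a => v a.2) (fun a => a.2) (slice s z) (condLaw P z) -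
        covVX v P z * ∫ a, slice s z a ∂(condLaw P z)) ∂(lawZ P)) 0 :=
  h.hasDerivAt_integral_covariance (by fun_prop) (by fun_prop) (hP.1.mono fun _ hz => hz.2)
    hP.2.2.1

theorem IsPerturbation.integrable_absCov {P Q : ProbabilityMeasure (Obs 𝒵)} {s p : Obs 𝒵 → ℝ}
    {B t δ : ℝ} (h : IsPerturbation P Q s p B t δ) {f g : ℝ × ℝ → ℝ}
    (hf : Measurable f) (hg : Measurable g)
    (hfg : ∀ᵐ z ∂(lawZ P), CovExists f g (condLaw P z))
    (hint : Integrable (fun z => absCov f g (condLaw P z)) (lawZ P)) :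
    Integrable (fun z => absCov f g (condLaw Q z)) (lawZ Q) := by
  refine h.integrable_lawZ ((hint.const_mul 9).mono'
    (measurable_absCov_condLaw Q hf hg).aestronglyMeasurable ?_)
  filter_upwards [h.ae_covariance hfg] with z hz
  rw [Real.norm_eq_abs, abs_of_nonneg (absCov_nonneg _ _ _)]
  exact hz.2.2.1

theorem IsSubmodel.eventually_mem_lambdaBarModel {v : ℝ → ℝ} {P : ProbabilityMeasure (Obs 𝒵)}
    {s : Obs 𝒵 → ℝ} {Q : ℝ → ProbabilityMeasure (Obs 𝒵)} (h : IsSubmodel P s Q) (hv : Measurable v)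
    (hP : P ∈ lambdaBarModel v) : ∀ᶠ t in 𝓝 (0 : ℝ), Q t ∈ lambdaBarModel v := by
  obtain ⟨B, -, hB⟩ := h.exists_isPerturbation
  have hne : ∀ᶠ t in 𝓝 (0 : ℝ), ∫ z, covVX v (Q t) z ∂(lawZ (Q t)) ≠ 0 :=
    -- The denominator is differentiable along the submodel, hence continuous, and stays nonzero.
    (h.hasDerivAt_integral_covVX hv hP).continuousAt.eventually_ne
      (by rw [h.apply_zero]; exact hP.2.2.2)
  filter_upwards [hB 1 one_pos, hne] with t ⟨p, hp⟩ ht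
  exact ⟨hp.condCovExist hP.1,
    hp.integrable_absCov (by fun_prop) (by fun_prop) (hP.1.mono fun _ hz => hz.1) hP.2.1,
    hp.integrable_absCov (by fun_prop) (by fun_prop) (hP.1.mono fun _ hz => hz.2) hP.2.2.1, ht⟩

theorem isInfluenceFunction_phiLambdaBar {v : ℝ → ℝ} (hv : Measurable v)
    {P : ProbabilityMeasure (Obs 𝒵)} (hP : P ∈ lambdaBarModel v)
    (hβ : ∀ᵐ z ∂(lawZ P), covVX v P z ≠ 0)
    (hφ : MemLp (phiLambdaBar v P) 2 (P : Measure (Obs 𝒵))) :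
    IsInfluenceFunction (lambdaBarModel v) (lambdaBarEstimand v) P (phiLambdaBar v P) := by
  have hb := hP.2.2.2
  refine ⟨hφ, ?_, fun s Q hQ => ⟨hQ.eventually_mem_lambdaBarModel hv hP, ?_⟩⟩
  -- The constant 1 is not a score, but the identity needs only boundedness. Here `covDeriv` is
  -- twice the covariance, so each bracket is the covariance itself.
  · have h1 := integral_phiLambdaBar_mul hv hP hβ hφ (s := fun _ => 1) measurable_const (B := 1)
      (fun _ => by simp)
    have e : ∀ z : 𝒵, slice (fun _ : Obs 𝒵 => (1 : ℝ)) z = fun _ => 1 := fun _ => rfl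
    simp only [mul_one, e, covDeriv_one, integral_const, probReal_univ, smul_eq_mul] at h1
    have e1 : ∀ z, 2 * covariance (fun a : ℝ × ℝ => v a.2) (fun a => a.1) (condLaw P z) -
        covVY v P z = covVY v P z := fun z => by rw [covVY]; ring
    have e2 : ∀ z, 2 * covariance (fun a : ℝ × ℝ => v a.2) (fun a => a.2) (condLaw P z) -
        covVX v P z = covVX v P z := fun z => by rw [covVX]; ring
    simp only [e1, e2] at h1
    rw [h1, lambdaBarEstimand, div_mul_cancel₀ _ hb, sub_self, zero_div]
  · obtain ⟨B, hB⟩ := hQ.2.1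
    rw [integral_phiLambdaBar_mul hv hP hβ hφ hQ.1 hB]
    have hd := (hQ.hasDerivAt_integral_covVY hv hP).div (hQ.hasDerivAt_integral_covVX hv hP)
      (by rw [hQ.apply_zero]; exact hb)
    rw [hQ.apply_zero] at hd
    refine hd.congr_deriv ?_
    rw [lambdaBarEstimand]
    field_simp

/-! ### The weighted effect with known weights -/

/-- The derivative of `λ(z)` times the density of `Z`, at `z`, in the direction of the score `s`. -/
noncomputable def effectDeriv (v : ℝ → ℝ) (P : ProbabilityMeasure (Obs 𝒵)) (s : Obs 𝒵 → ℝ)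
    (z : 𝒵) : ℝ :=
  covDeriv (fun a => v a.2) (fun a => a.1) (slice s z) (condLaw P z) / covVX v P z +
    condEffect v P z * (∫ a, slice s z a ∂(condLaw P z)) -
    condEffect v P z *
      (covDeriv (fun a => v a.2) (fun a => a.2) (slice s z) (condLaw P z) / covVX v P z)

/-- The bounds on the conditional covariances at a point `z` that the expansion of the effect
needs. -/
structure EffectBounds (v : ℝ → ℝ) (P : ProbabilityMeasure (Obs 𝒵)) (M : ℝ) (z : 𝒵) : Prop where
  covY : CovExists (fun a => v a.2) (fun a => a.1) (condLaw P z)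
  covX : CovExists (fun a => v a.2) (fun a => a.2) (condLaw P z)
  ne_zero : covVX v P z ≠ 0
  absCov_le : absCovVX v P z ≤ M * |covVX v P z|

theorem exists_effectBounds {v : ℝ → ℝ} {w : 𝒵 → ℝ} {P : ProbabilityMeasure (Obs 𝒵)}
    (hP : P ∈ lambdaModel v w) : ∃ M : ℝ, 1 ≤ M ∧ ∀ᵐ z ∂(lawZ P), EffectBounds v P M z := by
  obtain ⟨hcov, hne, ⟨K, hK⟩, -⟩ := hP
  -- Having `M ≥ 1` lets `B M` and `M (|t| B² + 4 ε)` bound numerator and denominator alike.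
  refine ⟨max 1 K, le_max_left _ _, ?_⟩
  filter_upwards [hcov, hne, hK] with z h1 h2 h3
  exact ⟨h1.1, h1.2, h2, h3.trans (mul_le_mul_of_nonneg_right (le_max_right _ _) (abs_nonneg _))⟩

namespace EffectBounds

variable {v : ℝ → ℝ} {P : ProbabilityMeasure (Obs 𝒵)} {M : ℝ} {z : 𝒵}

theorem abs_pos (h : EffectBounds v P M z) : 0 < |covVX v P z| := _root_.abs_pos.2 h.ne_zero

theorem abs_condEffect_le (h : EffectBounds v P M z) :
    |condEffect v P z| ≤ absCovVY v P z / |covVX v P z| := by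
  rw [condEffect, abs_div]
  refine div_le_div_of_nonneg_right ?_ h.abs_pos.le
  have h1 : 2 * |covVY v P z| ≤ absCovVY v P z := h.covY.abs_covariance_le
  linarith [abs_nonneg (covVY v P z)]

theorem abs_covDeriv_fst_div_le (h : EffectBounds v P M z) {s : Obs 𝒵 → ℝ} (hs : Measurable s)
    {B : ℝ} (hB : ∀ o, |s o| ≤ B) :
    |covDeriv (fun a => v a.2) (fun a => a.1) (slice s z) (condLaw P z) / covVX v P z| ≤
      B * (absCovVY v P z / |covVX v P z|) := by
  rw [abs_div, ← mul_div_assoc]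
  exact div_le_div_of_nonneg_right (h.covY.abs_covDeriv_le (measurable_slice hs z) fun _ => hB _)
    h.abs_pos.le

/-- The comparison of β_* with `|β|` makes the relative change of the denominator bounded
independently of `z`. -/
theorem abs_covDeriv_snd_div_le (h : EffectBounds v P M z) {s : Obs 𝒵 → ℝ} (hs : Measurable s)
    {B : ℝ} (hB : ∀ o, |s o| ≤ B) (hB0 : 0 ≤ B) :
    |covDeriv (fun a => v a.2) (fun a => a.2) (slice s z) (condLaw P z) / covVX v P z| ≤
      B * M := by
  rw [abs_div, div_le_iff₀ h.abs_pos, mul_assoc]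
  exact (h.covX.abs_covDeriv_le (measurable_slice hs z) fun _ => hB _).trans
    (mul_le_mul_of_nonneg_left h.absCov_le hB0)

theorem abs_effectDeriv_le (h : EffectBounds v P M z) {s : Obs 𝒵 → ℝ} (hs : Measurable s)
    {B : ℝ} (hB : ∀ o, |s o| ≤ B) (hB0 : 0 ≤ B) :
    |effectDeriv v P s z| ≤ (2 * B + B * M) * (absCovVY v P z / |covVX v P z|) := by
  have h1 := abs_le.1 (h.abs_covDeriv_fst_div_le hs hB)
  have hG : 0 ≤ absCovVY v P z / |covVX v P z| := div_nonneg (absCov_nonneg _ _ _) (abs_nonneg _)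
  have h2 : |condEffect v P z * (∫ a, slice s z a ∂(condLaw P z))| ≤
      absCovVY v P z / |covVX v P z| * B := by
    rw [abs_mul]
    exact mul_le_mul h.abs_condEffect_le (abs_integral_slice_le P hB z) (abs_nonneg _) hG
  have h3 : |condEffect v P z *
      (covDeriv (fun a => v a.2) (fun a => a.2) (slice s z) (condLaw P z) / covVX v P z)| ≤
      absCovVY v P z / |covVX v P z| * (B * M) := by
    rw [abs_mul]
    exact mul_le_mul h.abs_condEffect_le (h.abs_covDeriv_snd_div_le hs hB hB0) (abs_nonneg _) hG
  have h2' := abs_le.1 h2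
  have h3' := abs_le.1 h3
  rw [effectDeriv]
  exact abs_le.2 ⟨by linarith, by linarith⟩

end EffectBounds

theorem measurable_covVX {v : ℝ → ℝ} (hv : Measurable v) (P : ProbabilityMeasure (Obs 𝒵)) :
    Measurable (covVX v P) :=
  measurable_covariance_condLaw P (f := fun a => v a.2) (g := fun a => a.2) (by fun_prop)
    (by fun_prop)

theorem measurable_covVY {v : ℝ → ℝ} (hv : Measurable v) (P : ProbabilityMeasure (Obs 𝒵)) :
    Measurable (covVY v P) :=
  measurable_covariance_condLaw P (f := fun a => v a.2) (g := fun a => a.1) (by fun_prop)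
    (by fun_prop)

theorem measurable_condEffect {v : ℝ → ℝ} (hv : Measurable v) (P : ProbabilityMeasure (Obs 𝒵)) :
    Measurable (condEffect v P) :=
  (measurable_covVY hv P).div (measurable_covVX hv P)

theorem measurable_effectDeriv {v : ℝ → ℝ} (hv : Measurable v) (P : ProbabilityMeasure (Obs 𝒵))
    {s : Obs 𝒵 → ℝ} (hs : Measurable s) : Measurable (effectDeriv v P s) := by
  have h1 := measurable_covVX hv P
  have h2 := measurable_condEffect hv P
  have h3 := measurable_integral_condLaw P hs
  have h4 := measurable_covDeriv_condLaw P (f := fun a => v a.2) (g := fun a => a.1)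
    (by fun_prop) (by fun_prop) hs
  have h5 := measurable_covDeriv_condLaw P (f := fun a => v a.2) (g := fun a => a.2)
    (by fun_prop) (by fun_prop) hs
  exact ((h4.div h1).add (h2.mul h3)).sub (h2.mul (h5.div h1))

theorem abs_weight_mul_div {v : ℝ → ℝ} (w : 𝒵 → ℝ) (P : ProbabilityMeasure (Obs 𝒵)) (z : 𝒵) :
    |w z * absCovVY v P z / covVX v P z| = |w z| * (absCovVY v P z / |covVX v P z|) := by
  rw [abs_div, abs_mul, abs_of_nonneg (show 0 ≤ absCovVY v P z from absCov_nonneg _ _ _),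
    mul_div_assoc]

theorem integrable_weight_mul_condEffect {v : ℝ → ℝ} (hv : Measurable v) {w : 𝒵 → ℝ}
    (hw : Measurable w) {P : ProbabilityMeasure (Obs 𝒵)} (hP : P ∈ lambdaModel v w) :
    Integrable (fun z => w z * condEffect v P z) (lawZ P) := by
  obtain ⟨M, -, hM⟩ := exists_effectBounds hP
  refine hP.2.2.2.abs.mono' (hw.mul (measurable_condEffect hv P)).aestronglyMeasurable ?_
  filter_upwards [hM] with z hz
  rw [abs_weight_mul_div, Real.norm_eq_abs, abs_mul]
  exact mul_le_mul_of_nonneg_left hz.abs_condEffect_le (abs_nonneg _)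

theorem integrable_weight_mul_effectDeriv {v : ℝ → ℝ} (hv : Measurable v) {w : 𝒵 → ℝ}
    (hw : Measurable w) {P : ProbabilityMeasure (Obs 𝒵)} (hP : P ∈ lambdaModel v w)
    {s : Obs 𝒵 → ℝ} (hs : Measurable s) {B : ℝ} (hB : ∀ o, |s o| ≤ B) (hB0 : 0 ≤ B) :
    Integrable (fun z => w z * effectDeriv v P s z) (lawZ P) := by
  obtain ⟨M, -, hM⟩ := exists_effectBounds hP
  refine (hP.2.2.2.abs.const_mul (2 * B + B * M)).mono'
    (hw.mul (measurable_effectDeriv hv P hs)).aestronglyMeasurable ?_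
  filter_upwards [hM] with z hz
  rw [abs_weight_mul_div, Real.norm_eq_abs, abs_mul, mul_left_comm]
  exact mul_le_mul_of_nonneg_left (hz.abs_effectDeriv_le hs hB hB0) (abs_nonneg _)

theorem integral_linear_combination {α : Type*} [MeasurableSpace α] {μ : Measure α}
    {F G H : α → ℝ} (hF : Integrable F μ) (hG : Integrable G μ) (hH : Integrable H μ)
    (a b c : ℝ) : ∫ x, (a * F x - b * G x + c * H x) ∂μ =
      a * ∫ x, F x ∂μ - b * ∫ x, G x ∂μ + c * ∫ x, H x ∂μ := by
  have h1 : Integrable (fun x => a * F x - b * G x) μ := (hF.const_mul a).sub (hG.const_mul b)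
  rw [integral_add h1 (hH.const_mul c), integral_sub (hF.const_mul a) (hG.const_mul b),
    integral_const_mul, integral_const_mul, integral_const_mul]

/-- Stated without centring `s`: the last term vanishes for scores, while `s = 1` shows that the
curve has mean zero. -/
theorem integral_phiLambda_mul {v : ℝ → ℝ} (hv : Measurable v) {w : 𝒵 → ℝ} (hw : Measurable w)
    {P : ProbabilityMeasure (Obs 𝒵)} (hP : P ∈ lambdaModel v w)
    (hφ : MemLp (phiLambda v w P) 2 (P : Measure (Obs 𝒵))) {s : Obs 𝒵 → ℝ} (hs : Measurable s)
    {B : ℝ} (hB : ∀ o, |s o| ≤ B) (hB0 : 0 ≤ B) :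
    ∫ o, phiLambda v w P o * s o ∂(P : Measure (Obs 𝒵)) =
      (∫ z, w z * effectDeriv v P s z ∂(lawZ P)) -
        lambdaEstimand v w P * ∫ o, s o ∂(P : Measure (Obs 𝒵)) := by
  obtain ⟨M, -, hM⟩ := exists_effectBounds hP
  have hsi : Integrable s (P : Measure (Obs 𝒵)) :=
    Integrable.of_bound hs.aestronglyMeasurable B (ae_of_all _ hB)
  have hsz : Integrable (fun z => ∫ a, slice s z a ∂(condLaw P z)) (lawZ P) :=
    Integrable.of_bound (measurable_integral_condLaw P hs).aestronglyMeasurable B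
      (ae_of_all _ (abs_integral_slice_le P hB))
  rw [integral_obs P (integrable_mul_of_abs_le (hφ.integrable one_le_two) hs hB),
    integral_obs P hsi, ← integral_const_mul,
    ← integral_sub (integrable_weight_mul_effectDeriv hv hw hP hs hB hB0) (hsz.const_mul _)]
  refine integral_congr_ae ?_
  filter_upwards [hM] with z hz
  have hσ := measurable_slice hs z
  have hσB : ∀ a, |slice s z a| ≤ B := fun _ => hB _
  have hβ := hz.ne_zero
  have i0 : Integrable (slice s z) (condLaw P z) :=
    Integrable.of_bound hσ.aestronglyMeasurable B (ae_of_all _ hσB)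
  have i1 := hz.covY.integrable_score_mul hσ hσB (∫ a, v a.2 ∂(condLaw P z))
    (∫ a, a.1 ∂(condLaw P z))
  have i2 := hz.covX.integrable_score_mul hσ hσB (∫ a, v a.2 ∂(condLaw P z))
    (∫ a, a.2 ∂(condLaw P z))
  have e1 : ∀ a, slice (fun o => phiLambda v w P o * s o) z a =
      w z / covVX v P z * (slice s z a * ((v a.2 - ∫ a, v a.2 ∂(condLaw P z)) *
        (a.1 - ∫ a, a.1 ∂(condLaw P z)))) -
      w z * condEffect v P z / covVX v P z * (slice s z a * ((v a.2 - ∫ a, v a.2 ∂(condLaw P z)) *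
        (a.2 - ∫ a, a.2 ∂(condLaw P z)))) +
      (w z * condEffect v P z - lambdaEstimand v w P) * slice s z a := fun a => by
    simp only [slice, phiLambda, icLambda, contrast, outcomeMean, exposureMean, vMean]
    ring
  simp only [e1]
  rw [integral_linear_combination i1 i2 i0]
  simp only [effectDeriv, covDeriv]
  change _ = w z * ((_ + covVY v P z * _) / _ + _ - _ * ((_ + covVX v P z * _) / _)) - _
  simp only [condEffect]
  field_simp
  ring

/-- First-order expansion, along a perturbation, of `λ(z)` times the density of `Z` at `z`. -/
theorem IsPerturbation.effect_expansion {v : ℝ → ℝ} {P Q : ProbabilityMeasure (Obs 𝒵)}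
    {s p : Obs 𝒵 → ℝ} {B t ε M : ℝ} (hp : IsPerturbation P Q s p B t (ε * |t|)) (hB0 : 0 ≤ B)
    (hε : 0 < ε) (hM : 1 ≤ M) (hP : ∀ᵐ z ∂(lawZ P), EffectBounds v P M z)
    (h1 : |t| * (B * M) ≤ 1 / 4) (h2 : M * (|t| * B ^ 2 + 4 * ε) * |t| ≤ 1 / 4) :
    ∀ᵐ z ∂(lawZ P), |covVX v P z| ≤ 9 / 2 * |covVX v Q z| ∧
      |(∫ a, slice p z a ∂(condLaw P z)) * condEffect v Q z - condEffect v P z -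
        t * effectDeriv v P s z| ≤
          (8 * (|t| * (B * M) ^ 2) + 10 * (M * (|t| * B ^ 2 + 4 * ε))) * |t| *
            (absCovVY v P z / |covVX v P z|) := by
  filter_upwards [hP, hp.ae_covariance (hP.mono fun _ hz => hz.covY),
    hp.ae_covariance (hP.mono fun _ hz => hz.covX)] with z hz ⟨_, hcY, _, hrY⟩ ⟨_, hcX, _, hrX⟩
  have hs := hp.measurable_score
  set c := ∫ a, slice p z a ∂(condLaw P z) with hcdef
  obtain ⟨hc1, hc2⟩ := hp.mass_bounds z
  rw [← hcdef] at hc1 hc2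
  have hc0 : 0 < c := by linarith
  set TY := tiltCov (fun a => v a.2) (fun a => a.1) (slice p z) (condLaw P z)
  set TX := tiltCov (fun a => v a.2) (fun a => a.2) (slice p z) (condLaw P z)
  set DY := covDeriv (fun a => v a.2) (fun a => a.1) (slice s z) (condLaw P z) with hDY
  set DX := covDeriv (fun a => v a.2) (fun a => a.2) (slice s z) (condLaw P z) with hDX
  have hcY' : covVY v Q z = TY / c ^ 2 := hcY
  have hcX' : covVX v Q z = TX / c ^ 2 := hcX
  have hβ := hz.ne_zero
  have hβ0 := hz.abs_pos
  have hη0 : 0 ≤ |t| * B ^ 2 + 4 * ε := by positivity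
  have hηM : |t| * B ^ 2 + 4 * ε ≤ M * (|t| * B ^ 2 + 4 * ε) := le_mul_of_one_le_left hη0 hM
  have hrem : t ^ 2 * B ^ 2 + 4 * (ε * |t|) = (|t| * B ^ 2 + 4 * ε) * |t| := by
    rw [← sq_abs t]; ring
  have hG : 0 ≤ absCovVY v P z / |covVX v P z| := div_nonneg (absCov_nonneg _ _ _) hβ0.le
  have hBM : B ≤ B * M := le_mul_of_one_le_right hB0 hM
  have he : |DX / covVX v P z| ≤ B * M := hz.abs_covDeriv_snd_div_le hs hp.score_le hB0
  -- Dividing numerator and denominator by the unperturbed `β` normalizes the denominator to be near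
  -- 1, uniformly in `z`.
  have hE : |TX / covVX v P z - 1 - t * (DX / covVX v P z)| ≤
      M * (|t| * B ^ 2 + 4 * ε) * |t| := by
    have e : TX / covVX v P z - 1 - t * (DX / covVX v P z) =
        (TX - covVX v P z - t * DX) / covVX v P z := by field_simp
    rw [e, abs_div, div_le_iff₀ hβ0]
    calc |TX - covVX v P z - t * DX| ≤ (t ^ 2 * B ^ 2 + 4 * (ε * |t|)) * absCovVX v P z := hrX
      _ ≤ (t ^ 2 * B ^ 2 + 4 * (ε * |t|)) * (M * |covVX v P z|) :=
          mul_le_mul_of_nonneg_left hz.absCov_le (by positivity)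
      _ = _ := by rw [hrem]; ring
  have hA : |TY / covVX v P z - condEffect v P z - t * (DY / covVX v P z)| ≤
      M * (|t| * B ^ 2 + 4 * ε) * |t| * (absCovVY v P z / |covVX v P z|) := by
    have e : TY / covVX v P z - condEffect v P z - t * (DY / covVX v P z) =
        (TY - covVY v P z - t * DY) / covVX v P z := by rw [condEffect]; field_simp
    rw [e, abs_div, ← mul_div_assoc]
    refine div_le_div_of_nonneg_right ?_ hβ0.le
    calc |TY - covVY v P z - t * DY| ≤ (t ^ 2 * B ^ 2 + 4 * (ε * |t|)) * absCovVY v P z := hrY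
      _ ≤ _ := by
        rw [hrem]
        exact mul_le_mul_of_nonneg_right (mul_le_mul_of_nonneg_right hηM (abs_nonneg t))
          (absCov_nonneg _ _ _)
  have hhalf := half_le_of_abs_sub_le he hE h1 h2
  have hTX : TX ≠ 0 := by
    rintro h0
    rw [h0, zero_div] at hhalf
    norm_num at hhalf
  constructor
  -- The factor `9/2` is this 2 times the bound `9/4` on the squared mass.
  · have hge : |covVX v P z| ≤ 2 * |TX| := by
      have := hhalf.trans (le_abs_self _)
      rw [abs_div, le_div_iff₀ hβ0] at this
      linarith
    rw [hcX', abs_div, abs_of_pos (by positivity : 0 < c ^ 2), ← mul_div_assoc,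
      le_div_iff₀ (by positivity)]
    have hcs : c ^ 2 ≤ 9 / 4 := by nlinarith
    calc |covVX v P z| * c ^ 2 ≤ 2 * |TX| * (9 / 4) :=
          mul_le_mul hge hcs (by positivity) (by positivity)
      _ = _ := by ring
  -- The squared masses cancel in the ratio of covariances, so the density of `Z` remains as the
  -- factor `S = c`.
  · have key := abs_mul_div_sub_le (a := condEffect v P z) (d := DY / covVX v P z)
      (A := TY / covVX v P z) (e := DX / covVX v P z) (E := TX / covVX v P z)
      (r := ∫ a, slice s z a ∂(condLaw P z)) (S := c) (G := absCovVY v P z / |covVX v P z|)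
      (L := B * M) (η := M * (|t| * B ^ 2 + 4 * ε)) (t := t) hG (by linarith) (by linarith)
      hz.abs_condEffect_le
      ((hz.abs_covDeriv_fst_div_le hs hp.score_le).trans (mul_le_mul_of_nonneg_right hBM hG))
      he ((abs_integral_slice_le P hp.score_le z).trans hBM) hA hE
      ((hp.abs_mass_sub_le z).trans (mul_le_mul_of_nonneg_right
        (by nlinarith [mul_nonneg (abs_nonneg t) (sq_nonneg B)]) (abs_nonneg t))) h1 h2
    have e1 : c * condEffect v Q z = TY / covVX v P z * c / (TX / covVX v P z) := by
      rw [condEffect, hcY', hcX']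
      field_simp
    rw [e1]
    exact key

theorem IsSubmodel.hasDerivAt_lambdaEstimand {v : ℝ → ℝ} (hv : Measurable v) {w : 𝒵 → ℝ}
    (hw : Measurable w) {P : ProbabilityMeasure (Obs 𝒵)} (hP : P ∈ lambdaModel v w)
    {s : Obs 𝒵 → ℝ} {Q : ℝ → ProbabilityMeasure (Obs 𝒵)} (h : IsSubmodel P s Q) :
    HasDerivAt (fun t => lambdaEstimand v w (Q t))
      (∫ z, w z * effectDeriv v P s z ∂(lawZ P)) 0 := by
  obtain ⟨M, hM, hbd⟩ := exists_effectBounds hP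
  obtain ⟨B, hB0, hB⟩ := h.exists_isPerturbation
  obtain ⟨p₁, hp₁⟩ := (hB 1 one_pos).self_of_nhds
  refine hasDerivAt_integral_of_remainder_le (integrable_weight_mul_condEffect hv hw hP)
    (integrable_weight_mul_effectDeriv hv hw hP h.1 hp₁.score_le hB0) hP.2.2.2.abs
    (fun z => abs_nonneg _) fun ε hε => ?_
  obtain ⟨ε', hε', hsmall⟩ := exists_eventually_small B hM hε
  filter_upwards [hB ε' hε', hsmall] with t ⟨p, hp⟩ ⟨s1, s2, s3⟩
  refine ⟨fun z => (∫ a, slice p z a ∂(condLaw P z)) * (w z * condEffect v (Q t) z),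
    (hp.measurable_mass.mul (hw.mul (measurable_condEffect hv _))).aestronglyMeasurable,
    hp.integral_lawZ _, ?_⟩
  filter_upwards [hp.effect_expansion hB0 hε' hM hbd s1 s2] with z ⟨_, hz⟩
  have e : (∫ a, slice p z a ∂(condLaw P z)) * (w z * condEffect v (Q t) z) -
      w z * condEffect v P z - t * (w z * effectDeriv v P s z) =
      w z * ((∫ a, slice p z a ∂(condLaw P z)) * condEffect v (Q t) z - condEffect v P z -
        t * effectDeriv v P s z) := by ring
  rw [e, abs_mul, abs_weight_mul_div, mul_left_comm]
  refine mul_le_mul_of_nonneg_left (hz.trans ?_) (abs_nonneg _)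
  exact mul_le_mul_of_nonneg_right (mul_le_mul_of_nonneg_right s3 (abs_nonneg t))
    (div_nonneg (absCov_nonneg _ _ _) (abs_nonneg _))

theorem IsSubmodel.eventually_mem_lambdaModel {v : ℝ → ℝ} (hv : Measurable v) {w : 𝒵 → ℝ}
    (hw : Measurable w) {P : ProbabilityMeasure (Obs 𝒵)} (hP : P ∈ lambdaModel v w)
    {s : Obs 𝒵 → ℝ} {Q : ℝ → ProbabilityMeasure (Obs 𝒵)} (h : IsSubmodel P s Q) :
    ∀ᶠ t in 𝓝 (0 : ℝ), Q t ∈ lambdaModel v w := by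
  obtain ⟨M, hM, hbd⟩ := exists_effectBounds hP
  obtain ⟨B, hB0, hB⟩ := h.exists_isPerturbation
  obtain ⟨ε', hε', hsmall⟩ := exists_eventually_small B hM one_pos
  filter_upwards [hB ε' hε', hsmall] with t ⟨p, hp⟩ ⟨s1, s2, _⟩
  have hexp := hp.effect_expansion hB0 hε' hM hbd s1 s2
  refine ⟨hp.condCovExist hP.1, hp.lawZ_absolutelyContinuous.ae_le ?_,
    -- The perturbation enlarges `absCov` by at most 9 and shrinks `|β|` by at most `9/2`; the
    -- constant in the model may change with the law.
    ⟨9 * (M * (9 / 2)), hp.lawZ_absolutelyContinuous.ae_le ?_⟩, hp.integrable_lawZ ?_⟩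
  · filter_upwards [hexp, hbd] with z hz hb h0
    have := hz.1
    rw [h0, abs_zero, mul_zero] at this
    linarith [hb.abs_pos]
  · filter_upwards [hexp, hbd, hp.ae_covariance (hP.1.mono fun _ hz => hz.2)] with z hz hb hc
    have h9 : absCovVX v (Q t) z ≤ 9 * absCovVX v P z := hc.2.2.1
    have hMβ := mul_le_mul_of_nonneg_left hz.1 (by linarith : (0 : ℝ) ≤ M)
    linarith [hb.absCov_le]
  · have hmY : Measurable (absCovVY v (Q t)) :=
      measurable_absCov_condLaw (Q t) (f := fun a => v a.2) (g := fun a => a.1) (by fun_prop)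
        (by fun_prop)
    refine (hP.2.2.2.abs.const_mul (9 * (9 / 2))).mono'
      ((hw.mul hmY).div (measurable_covVX hv _)).aestronglyMeasurable ?_
    filter_upwards [hexp, hbd, hp.ae_covariance (hP.1.mono fun _ hz => hz.1)] with z hz hb hc
    have h9 : absCovVY v (Q t) z ≤ 9 * absCovVY v P z := hc.2.2.1
    have hq0 : 0 < |covVX v (Q t) z| := by linarith [hz.1, hb.abs_pos]
    rw [Real.norm_eq_abs, abs_weight_mul_div, abs_weight_mul_div, mul_left_comm]
    refine mul_le_mul_of_nonneg_left ?_ (abs_nonneg _)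
    have hY0 : 0 ≤ absCovVY v P z := absCov_nonneg _ _ _
    rw [← mul_div_assoc, div_le_div_iff₀ hq0 hb.abs_pos]
    calc absCovVY v (Q t) z * |covVX v P z|
        ≤ 9 * absCovVY v P z * (9 / 2 * |covVX v (Q t) z|) :=
          mul_le_mul h9 hz.1 (abs_nonneg _) (by positivity)
      _ = _ := by ring

theorem isInfluenceFunction_phiLambda {v : ℝ → ℝ} (hv : Measurable v) {w : 𝒵 → ℝ}
    (hw : Measurable w) {P : ProbabilityMeasure (Obs 𝒵)} (hP : P ∈ lambdaModel v w)
    (hφ : MemLp (phiLambda v w P) 2 (P : Measure (Obs 𝒵))) :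
    IsInfluenceFunction (lambdaModel v w) (lambdaEstimand v w) P (phiLambda v w P) := by
  refine ⟨hφ, ?_, fun s Q hQ => ⟨hQ.eventually_mem_lambdaModel hv hw hP, ?_⟩⟩
  -- For `s = 1` the derivative terms of numerator and denominator are `2λ` and `2λ`; they cancel,
  -- and the mass term leaves `λ`.
  · have h1 := integral_phiLambda_mul hv hw hP hφ (s := fun _ => 1) measurable_const (B := 1)
      (fun _ => by simp) zero_le_one
    simp only [mul_one, integral_const, probReal_univ, smul_eq_mul] at h1
    rw [h1, sub_eq_zero, lambdaEstimand]
    obtain ⟨M, -, hM⟩ := exists_effectBounds hP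
    refine integral_congr_ae ?_
    filter_upwards [hM] with z hz
    have e : slice (fun _ : Obs 𝒵 => (1 : ℝ)) z = fun _ => 1 := rfl
    have hβ := hz.ne_zero
    simp only [effectDeriv, e, covDeriv_one, integral_const, probReal_univ, smul_eq_mul]
    change w z * (2 * covVY v P z / _ + _ - _ * (2 * covVX v P z / _)) = _
    rw [condEffect]
    field_simp
    ring
  · have hd := hQ.hasDerivAt_lambdaEstimand hv hw hP
    obtain ⟨B, hB⟩ := hQ.2.1
    refine hd.congr_deriv ?_
    rw [integral_phiLambda_mul hv hw hP hφ hQ.1 (fun o => (hB o).trans (le_abs_self B))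
      (abs_nonneg B), hQ.integral_score_eq_zero, mul_zero, sub_zero]

end ContrastEffect

/-! ### Assembly of the main theorem. -/

theorem mainTheorem5 {𝒵 : Type*} [MeasurableSpace 𝒵] (v : ℝ → ℝ) (hv : Measurable v) :
    -- the influence function of `E{w(Z) λ(Z)}` for known `w`
    (∀ (w : 𝒵 → ℝ), Measurable w →
      ∀ P : ProbabilityMeasure (ContrastEffect.Obs 𝒵),
        P ∈ ContrastEffect.lambdaModel v w →
        MemLp (ContrastEffect.phiLambda v w P) 2 (P : Measure (ContrastEffect.Obs 𝒵)) →
        ContrastEffect.IsTheInfluenceFunction (ContrastEffect.lambdaModel v w)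
          (ContrastEffect.lambdaEstimand v w) P (ContrastEffect.phiLambda v w P)) ∧
    -- `Λ̄` is the estimand with weight proportional to `Cov{v(X), X | Z}`; its influence function
    (∀ P : ProbabilityMeasure (ContrastEffect.Obs 𝒵),
        P ∈ ContrastEffect.lambdaBarModel v →
        (∀ᵐ z ∂(ContrastEffect.lawZ P), ContrastEffect.covVX v P z ≠ 0) →
        MemLp (ContrastEffect.phiLambdaBar v P) 2 (P : Measure (ContrastEffect.Obs 𝒵)) →
        ∫ z, ContrastEffect.covWeight v P z ∂(ContrastEffect.lawZ P) = 1 ∧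
        ContrastEffect.lambdaBarEstimand v P =
          ∫ z, ContrastEffect.covWeight v P z * ContrastEffect.condEffect v P z
            ∂(ContrastEffect.lawZ P) ∧
        ContrastEffect.IsTheInfluenceFunction (ContrastEffect.lambdaBarModel v)
          (ContrastEffect.lambdaBarEstimand v) P (ContrastEffect.phiLambdaBar v P)) ∧
    -- setting the sample mean of the fitted influence curve to zero gives the estimators
    (∀ (w ρ β m π lam : 𝒵 → ℝ) (n : ℕ), 0 < n → ∀ (o : Fin n → ContrastEffect.Obs 𝒵) (θ : ℝ),
      (n : ℝ)⁻¹ * ∑ i, ContrastEffect.icLambda v w ρ β m π lam θ (o i) = 0 ↔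
        θ = ContrastEffect.lambdaHat v w ρ β m π lam o) ∧
    (∀ (ρ β m π : 𝒵 → ℝ) (c : ℝ), c ≠ 0 →
      ∀ (n : ℕ) (o : Fin n → ContrastEffect.Obs 𝒵), (∀ i, β (o i).2.2 ≠ 0) →
      ∑ i, (v (o i).2.1 - ρ (o i).2.2) * ((o i).2.1 - π (o i).2.2) ≠ 0 → ∀ θ : ℝ,
      ((n : ℝ)⁻¹ * ∑ i, ContrastEffect.icLambdaBar v (fun z => β z / c) ρ β m π θ (o i) = 0 ↔
        θ = ContrastEffect.lambdaBarHat v ρ m π o)) := by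
  refine ⟨fun w hw P hP hφ => ?_, fun P hP hβ hφ =>
    ⟨?_, ContrastEffect.covariance_weighted_effect hβ, ?_⟩, ?_, ?_⟩
  · have h := ContrastEffect.isInfluenceFunction_phiLambda hv hw hP hφ
    exact ⟨h, fun _ h' => h.ae_eq h'⟩
  · simp only [ContrastEffect.covWeight]
    rw [integral_div, div_self hP.2.2.2]
  · have h := ContrastEffect.isInfluenceFunction_phiLambdaBar hv hP hβ hφ
    exact ⟨h, fun _ h' => h.ae_eq h'⟩
  · exact fun w ρ β m π lam n hn o θ =>
      ContrastEffect.mean_icLambda_eq_zero_iff v w ρ β m π lam hn o θ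
  · exact fun ρ β m π c hc n o hβ hne θ =>
      ContrastEffect.mean_icLambdaBar_eq_zero_iff v ρ β m π hc o hβ hne θ
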